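/- Let $n\in\mathbb N$. An $n$-dimensional charge is a $\sigma$-additive function $\mu=(\mu_1,\dots,\mu_n)$ from the Borel $\sigma$-algebra of $\mathbb R^n$ to $\mathbb R^n$. It acts on bounded measurable vector fields $\varphi=(\varphi_1,\dots,\varphi_n):\mathbb R^n\to\mathbb R^n$ by $\langle\mu,\varphi\rangle=\sum_{k=1}^n\int\varphi_k\,d\mu_k$. Its variation measure is the finite positive Borel measure $\|\mu\|(E)=\sup\{\sum_{k}|\mu(E_k)| : E_k\subseteq E \text{ pairwise disjoint Borel sets}\}$, where $|\cdot|$ is the Euclidean norm; $\operatorname{Var}(\mu)=\|\mu\|(\mathbb R^n)$, $\operatorname{supp}(\mu)$ is the support of $\|\mu\|$, and $\operatorname{Div}(\mu)$ is the distribution $\langle\operatorname{Div}(\mu),\psi\rangle=-\langle\mu,\nabla\psi\rangle$ for $\psi\in C_c^\infty(\mathbb R^n)$. For $\ell>0$ let $K_\ell$ be the set of all $1$-Lipschitz curves $\gamma:[0,\ell]\to\mathbb R^n$ (Euclidean norm), with the topology of uniform convergence and its Borel $\sigma$-algebra. For $\gamma\in K_\ell$ let $[\gamma]$ be the charge $[\gamma](A)=\int_{\{t\in[0,\ell]\,:\,\gamma(t)\in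 A\}}\dot\gamma(t)\,dt$, so that $\langle[\gamma],\varphi\rangle=\int_0^\ell\langle\varphi(\gamma(t)),\dot\gamma(t)\rangle\,dt$, and let $L(\gamma)=\int_0^\ell|\dot\gamma(t)|\,dt$ be the length of $\gamma$. **Theorem.** For every $\ell>0$ and every $n$-dimensional charge $\mu$ with $\operatorname{Div}(\mu)=0$ there is a finite positive Borel measure $\nu$ on $K_\ell$ such that $$\mu=\int_{K_\ell}[\gamma]\,d\nu(\gamma)\qquad\text{and}\qquad \|\mu\|=\int_{K_\ell}\|[\gamma]\|\,d\nu(\gamma),$$ and such that $\nu$-almost every $\gamma\in K_\ell$ takes all its values in $\operatorname{supp}(\mu)$ and satisfies $\operatorname{Var}([\gamma])=L(\gamma)=\ell$. Here the first identity means that for every continuous vector field $\varphi:\mathbb R^n\to\mathbb R^n$ with compact support the function $\gamma\mapsto\langle[\gamma],\varphi\rangle$ is $\nu$-integrable and $\langle\mu,\varphi\rangle=\int_{K_\ell}\langle[\gamma],\varphi\rangle\,d\nu(\gamma)$; the second means that for every Borel set $A\subseteq\mathbb R^n$ the function $\gamma\mapsto\|[\gamma]\|(A)$ is $\nu$-measurable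 and $\|\mu\|(A)=\int_{K_\ell}\|[\gamma]\|(A)\,d\nu(\gamma)$. -/

import Mathlib

open MeasureTheory Set
open scoped ENNReal Distributions Gradient

noncomputable section

namespace Smirnov

/-- The Euclidean space `ℝⁿ`, with the Euclidean norm and its Borel σ-algebra. -/
abbrev Rn (n : ℕ) : Type := EuclideanSpace ℝ (Fin n)

/-- An `n`-dimensional charge: a σ-additive function from the Borel σ-algebra of `ℝⁿ` to `ℝⁿ`. Its
variation measure is `VectorMeasure.variation`. -/
abbrev Charge (n : ℕ) : Type := VectorMeasure (Rn n) (Rn n)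

variable {n : ℕ} {ℓ : ℝ}

/-- The variation measure of a charge is finite, so that bounded measurable fields are integrable
against it and the action below is never a junk value for them. -/
theorem Charge.isFiniteMeasure_variation (μ : Charge n) :
    IsFiniteMeasure (VectorMeasure.variation μ) := by
  let s : Fin n → SignedMeasure (Rn n) := fun k =>
    μ.mapRange (EuclideanSpace.proj (𝕜 := ℝ) k : Rn n →L[ℝ] ℝ).toLinearMap.toAddMonoidHom
      (EuclideanSpace.proj (𝕜 := ℝ) k : Rn n →L[ℝ] ℝ).continuous
  refine @isFiniteMeasure_of_le _ _ _ (∑ k, (s k).variation) ?_ ?_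
  · refine ⟨?_⟩
    simp only [Measure.coe_finsetSum, Finset.sum_apply]
    refine ENNReal.sum_lt_top.2 fun k _ => ?_
    rw [← SignedMeasure.totalVariation_eq_variation, SignedMeasure.totalVariation]
    exact measure_lt_top _ _
  · refine VectorMeasure.variation_le_of_forall_enorm_le fun E hE => ?_
    simp only [Measure.coe_finsetSum, Finset.sum_apply]
    refine le_trans ?_ (Finset.sum_le_sum fun k _ => (s k).enorm_measure_le_variation E)
    have : ‖μ E‖ₑ ≤ ∑ k, ‖(μ E) k‖ₑ := by
      conv_lhs => rw [← (EuclideanSpace.basisFun (Fin n) ℝ).sum_repr (μ E)]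
      refine (enorm_sum_le _ _).trans (Finset.sum_le_sum fun k _ => ?_)
      rw [enorm_smul]
      simp [enorm_eq_nnnorm]
    exact this

/-- The action `⟨μ, φ⟩ = ∑ₖ ∫ φₖ dμₖ` of a charge on a vector field: the integral of `φ` against
the vector measure `μ` with respect to the Euclidean inner product. -/
def Charge.pairing (μ : Charge n) (φ : Rn n → Rn n) : ℝ :=
  VectorMeasure.integral μ φ (innerSL ℝ)

/-- The distributional divergence of a charge, a functional on the test functions on `ℝⁿ`:
`⟨Div μ, ψ⟩ = -⟨μ, ∇ψ⟩`. -/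
def Charge.div (μ : Charge n) : 𝓓((⊤ : TopologicalSpace.Opens (Rn n)), ℝ) → ℝ :=
  fun ψ => -Charge.pairing μ (∇ ψ)

/-- The total variation of a charge. -/
def Charge.totalVar (μ : Charge n) : ℝ≥0∞ := VectorMeasure.variation μ univ

/-- The support of a charge: the points all of whose neighbourhoods have positive variation. -/
def Charge.supp (μ : Charge n) : Set (Rn n) := (VectorMeasure.variation μ).support

/-- `C([0,ℓ], ℝⁿ)` carries the Borel σ-algebra of the topology of uniform convergence. -/
instance : MeasurableSpace C(Icc (0 : ℝ) ℓ, Rn n) := borel _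

instance : BorelSpace C(Icc (0 : ℝ) ℓ, Rn n) := ⟨rfl⟩

variable (n ℓ) in
/-- The space `K_ℓ` of `1`-Lipschitz curves `[0,ℓ] → ℝⁿ`, as a subspace of `C([0,ℓ], ℝⁿ)`. -/
abbrev Curve : Type := {γ : C(Icc (0 : ℝ) ℓ, Rn n) // LipschitzWith 1 γ}

variable (ℓ) in
/-- Lebesgue measure on the interval `[0,ℓ]`. -/
def lebesgue : Measure (Icc (0 : ℝ) ℓ) := (volume : Measure ℝ).comap Subtype.val

/-- The derivative of a curve. The curve is extended by `0` to the real line, which does not affect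
the derivative on the open interval `(0,ℓ)`. -/
def Curve.velocity (γ : Curve n ℓ) (t : Icc (0 : ℝ) ℓ) : Rn n :=
  deriv (Function.extend Subtype.val γ.1 0) (t : ℝ)

theorem Curve.integrable_velocity (γ : Curve n ℓ) : Integrable γ.velocity (lebesgue ℓ) := by
  have hsub := MeasurableEmbedding.subtype_coe (measurableSet_Icc (a := (0 : ℝ)) (b := ℓ))
  have hfin : IsFiniteMeasure (lebesgue ℓ) := by
    refine ⟨?_⟩
    rw [lebesgue, hsub.comap_apply]
    refine (measure_mono (t := Icc 0 ℓ) ?_).trans_lt (by simp)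
    rintro _ ⟨x, _, rfl⟩
    exact x.2
  have hI : ∀ᵐ t ∂lebesgue ℓ, t.1 ∈ Ioo 0 ℓ := by
    rw [ae_iff, lebesgue, hsub.comap_apply]
    refine measure_mono_null (t := {0, ℓ}) ?_ ((Set.toFinite _).measure_zero _)
    rintro _ ⟨x, hx, rfl⟩
    have h1 := x.2.1
    have h2 := x.2.2
    simp only [mem_ofPred_eq, mem_Ioo, not_and_or, not_lt] at hx
    rcases hx with h | h
    · exact Or.inl (le_antisymm h h1)
    · exact Or.inr (le_antisymm h2 h)
  refine Integrable.of_bound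
    ((measurable_deriv _).comp measurable_subtype_coe).aestronglyMeasurable 1 ?_
  filter_upwards [hI] with t ht
  have hval : ∀ t : Icc 0 ℓ, Function.extend Subtype.val γ.1 0 t.1 = γ.1 t := fun t =>
    Subtype.val_injective.extend_apply _ _ _
  have := norm_deriv_le_of_lipschitzOn (f := Function.extend Subtype.val γ.1 0) (x₀ := t.1)
    (s := Icc 0 ℓ) (C := 1) (Icc_mem_nhds ht.1 ht.2) (by
      intro x hx y hy
      simpa only [hval ⟨x, hx⟩, hval ⟨y, hy⟩] using! γ.2 ⟨x, hx⟩ ⟨y, hy⟩)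
  simpa using! this

/-- The charge `[γ]` of a curve: the push-forward under `γ` of the vector measure `γ̇ · λ¹` on
`[0,ℓ]`, i.e. `[γ](A) = ∫_{γ ∈ A} γ̇ dλ¹`. -/
def Curve.charge (γ : Curve n ℓ) : Charge n :=
  ((lebesgue ℓ).withDensityᵥ γ.velocity).map γ.1

theorem Curve.charge_apply (γ : Curve n ℓ) {A : Set (Rn n)} (hA : MeasurableSet A) :
    γ.charge A = ∫ t in γ.1 ⁻¹' A, γ.velocity t ∂lebesgue ℓ := by
  have hm : Measurable γ.1 := γ.1.continuous.measurable
  rw [Curve.charge, VectorMeasure.map_apply _ hm hA,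
    withDensityᵥ_apply γ.integrable_velocity (hm hA)]

/-- The length `L(γ) = ∫_{[0,ℓ]} |γ̇| dλ¹` of a curve. -/
def Curve.length (γ : Curve n ℓ) : ℝ≥0∞ := ∫⁻ t, ‖γ.velocity t‖ₑ ∂lebesgue ℓ

/-- `μ = ∫ [γ] dν(γ)` in the weak sense: `⟨μ, φ⟩ = ∫ ⟨[γ], φ⟩ dν(γ)` for all continuous
vector fields `φ` with compact support. -/
def IsDecomposition (μ : Charge n) (ν : Measure (Curve n ℓ)) : Prop :=
  ∀ φ : Rn n → Rn n, Continuous φ → HasCompactSupport φ →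
    Integrable (fun γ : Curve n ℓ => γ.charge.pairing φ) ν ∧
      μ.pairing φ = ∫ γ : Curve n ℓ, γ.charge.pairing φ ∂ν

/-- `‖μ‖ = ∫ ‖[γ]‖ dν(γ)` as an identity of positive Borel measures. -/
def VariationDecomposes (μ : Charge n) (ν : Measure (Curve n ℓ)) : Prop :=
  ∀ A : Set (Rn n), MeasurableSet A →
    AEMeasurable (fun γ : Curve n ℓ => VectorMeasure.variation γ.charge A) ν ∧
      VectorMeasure.variation μ A = ∫⁻ γ : Curve n ℓ, VectorMeasure.variation γ.charge A ∂ν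

end Smirnov

end

/-! The measure `ν` is found by duality. Write M = ‖μ‖(ℝⁿ). Everything rests on
`Charge.mul_pairing_le`: if ⟨[γ],φ⟩ ≤ S for all γ in K_ℓ, then ℓ⟨μ,φ⟩ ≤ M S. To see this, let V(t,x)
be the supremum of ⟨[γ],φ⟩ over curves of duration t starting at x. Formally ∂ₜV = |φ + ∇V| and
V(0,·) = 0. Since Div μ = 0, ⟨μ,φ⟩ = ⟨μ,φ + ∇V⟩ ≤ ∫ ∂ₜV d‖μ‖, and integration over 0 ≤ t ≤ ℓ gives
ℓ⟨μ,φ⟩ ≤ ∫ V(ℓ,·) d‖μ‖ ≤ M S. As V need not be smooth, time is discretized (`value`,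
`le_value_succ`) and space is mollified (`Charge.mul_pairing_le_of_step`).

Hahn–Banach then extends ⟨[·],φ⟩ ↦ ⟨μ,φ⟩ to C_c(K_ℓ), dominated by f ↦ (M/ℓ) sup f⁺. Such an
extension is positive, and the Riesz theorem yields ν of mass at most M/ℓ
(`Charge.exists_isDecomposition`).

The rest is an equality case. From M ≤ ∫ Var([γ]) dν ≤ ℓ ν(K_ℓ) ≤ M, almost every γ has Var([γ]) =
L(γ) = ℓ. Likewise ‖μ‖ is dominated by the image of ν × λ¹ under (γ,t) ↦ γ(t), which has no larger
mass, so the two agree. Hence almost every γ spends no time off supp μ and, being continuous, never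
leaves it. -/

noncomputable section

namespace Smirnov

variable {n : ℕ} {ℓ : ℝ}

/-! ### The pairing of a charge with a vector field -/

instance (μ : Charge n) : IsFiniteMeasure (VectorMeasure.variation μ) :=
  μ.isFiniteMeasure_variation

theorem norm_innerSL_le_one : ‖(innerSL ℝ : Rn n →L[ℝ] Rn n →L[ℝ] ℝ)‖ ≤ 1 :=
  ContinuousLinearMap.opNorm_le_bound _ zero_le_one fun x => by simp

theorem Charge.integrable_of_continuous (μ : Charge n) {φ : Rn n → Rn n} (hφ : Continuous φ)
    (hs : HasCompactSupport φ) : Integrable φ (VectorMeasure.variation μ) :=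
  hφ.integrable_of_hasCompactSupport hs

theorem Charge.abs_pairing_le (μ : Charge n) (φ : Rn n → Rn n) :
    |μ.pairing φ| ≤ ∫ x, ‖φ x‖ ∂(VectorMeasure.variation μ) := by
  refine (VectorMeasure.norm_integral_le_integral_norm
    (μ := μ) (f := φ) (B := innerSL ℝ)).trans ?_
  exact mul_le_of_le_one_left (integral_nonneg fun _ => norm_nonneg _) norm_innerSL_le_one

theorem Charge.pairing_add (μ : Charge n) {φ ψ : Rn n → Rn n}
    (hφ : Integrable φ (VectorMeasure.variation μ))
    (hψ : Integrable ψ (VectorMeasure.variation μ)) :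
    μ.pairing (φ + ψ) = μ.pairing φ + μ.pairing ψ :=
  VectorMeasure.integral_add hφ hψ

theorem Charge.pairing_sub (μ : Charge n) {φ ψ : Rn n → Rn n}
    (hφ : Integrable φ (VectorMeasure.variation μ))
    (hψ : Integrable ψ (VectorMeasure.variation μ)) :
    μ.pairing (φ - ψ) = μ.pairing φ - μ.pairing ψ :=
  VectorMeasure.integral_sub hφ hψ

theorem Charge.pairing_smul (μ : Charge n) (c : ℝ) (φ : Rn n → Rn n) :
    μ.pairing (c • φ) = c * μ.pairing φ :=
  VectorMeasure.integral_smul φ μ (innerSL ℝ) c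

theorem Charge.pairing_indicator (μ : Charge n) {E : Set (Rn n)} (hE : MeasurableSet E)
    (e : Rn n) : μ.pairing (E.indicator fun _ => e) = inner ℝ e (μ E) :=
  VectorMeasure.integral_indicator_const (μ := μ) (B := innerSL ℝ) (s := E) e hE

/-! ### Approximation by continuous fields of compact support -/

/-- The radial retraction of a normed space onto its closed unit ball. -/
def unitBallRetraction (x : Rn n) : Rn n := (max 1 ‖x‖)⁻¹ • x

theorem continuous_unitBallRetraction : Continuous (unitBallRetraction (n := n)) := by
  unfold unitBallRetraction
  refine Continuous.smul (Continuous.inv₀ (continuous_const.max continuous_norm) fun x => ?_)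
    continuous_id
  positivity

theorem norm_unitBallRetraction_le (x : Rn n) : ‖unitBallRetraction x‖ ≤ 1 := by
  rw [unitBallRetraction, norm_smul, norm_inv, Real.norm_of_nonneg (by positivity),
    inv_mul_le_iff₀ (by positivity)]
  simp

/-- The retraction moves `x` exactly by its distance to the unit ball. Truncating an approximant of
a field bounded by 1 thus at most doubles the error. -/
theorem norm_sub_unitBallRetraction_le {x y : Rn n} (hy : ‖y‖ ≤ 1) :
    ‖x - unitBallRetraction x‖ ≤ ‖y - x‖ := by
  have h1 : ‖x‖ ≤ ‖y‖ + ‖y - x‖ := by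
    have := norm_sub_norm_le x y
    rw [norm_sub_rev] at this
    linarith
  rcases le_total ‖x‖ 1 with h | h
  · simp [unitBallRetraction, max_eq_left h]
  · have hx : 0 < ‖x‖ := by linarith
    have : x - unitBallRetraction x = (1 - ‖x‖⁻¹) • x := by
      rw [unitBallRetraction, max_eq_right h, sub_smul, one_smul]
    rw [this, norm_smul, Real.norm_of_nonneg (by simpa using inv_le_one_of_one_le₀ h), sub_mul,
      inv_mul_cancel₀ hx.ne']
    linarith

/-- On a partition that nearly attains the variation, take the field with value μ(E)/|μ(E)| on each
cell E; approximate it in L¹(‖μ‖) and retract to the unit ball. -/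
theorem Charge.exists_pairing_gt (μ : Charge n) {c : ℝ≥0∞}
    (hc : c < VectorMeasure.variation μ univ) :
    ∃ φ : Rn n → Rn n, Continuous φ ∧ HasCompactSupport φ ∧ (∀ x, ‖φ x‖ ≤ 1) ∧
      c.toReal < μ.pairing φ := by
  obtain ⟨P, -, hPd, hPm, hPc⟩ := μ.exists_lt_sum_of_lt_variation MeasurableSet.univ hc
  let ψ : Rn n → Rn n := ∑ E ∈ P, E.indicator fun _ => ‖μ E‖⁻¹ • μ E
  have hψi : ∀ E ∈ P, Integrable (E.indicator fun _ => ‖μ E‖⁻¹ • μ E)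
      (VectorMeasure.variation μ) := fun E hE =>
    (integrable_const _).indicator (hPm E hE)
  have hψint : Integrable ψ (VectorMeasure.variation μ) := integrable_finsetSum' _ hψi
  have hψ1 : ∀ x, ‖ψ x‖ ≤ 1 := by
    intro x
    by_cases hx : ∃ E ∈ P, x ∈ E
    · obtain ⟨E, hE, hxE⟩ := hx
      have : ψ x = ‖μ E‖⁻¹ • μ E := by
        simp only [ψ, Finset.sum_apply]
        rw [Finset.sum_eq_single_of_mem E hE]
        · simp [hxE]
        · intro F hF hne
          have : x ∉ F := fun hxF => (disjoint_left.1 (hPd hF hE hne)) hxF hxE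
          simp [this]
      rw [this, norm_smul, norm_inv, norm_norm]
      exact inv_mul_le_one
    · push Not at hx
      have : ψ x = 0 := by
        simp only [ψ, Finset.sum_apply]
        exact Finset.sum_eq_zero fun E hE => by simp [hx E hE]
      simp [this]
  have hψp : μ.pairing ψ = ∑ E ∈ P, ‖μ E‖ := by
    have h1 : μ.pairing ψ = ∑ E ∈ P, μ.pairing (E.indicator fun _ => ‖μ E‖⁻¹ • μ E) := by
      have : ψ = fun x => ∑ E ∈ P, (E.indicator fun _ => ‖μ E‖⁻¹ • μ E) x := by
        ext1 x; simp only [ψ, Finset.sum_apply]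
      rw [this]
      exact VectorMeasure.integral_finsetSum P hψi
    rw [h1]
    refine Finset.sum_congr rfl fun E hE => ?_
    rw [μ.pairing_indicator (hPm E hE), real_inner_smul_left, real_inner_self_eq_norm_sq]
    by_cases h0 : ‖μ E‖ = 0
    · simp [h0]
    · field_simp
  have hgt : c.toReal < μ.pairing ψ := by
    rw [hψp, ← ENNReal.lt_ofReal_iff_toReal_lt hc.ne_top,
      ENNReal.ofReal_sum_of_nonneg fun _ _ => norm_nonneg _]
    simpa only [ofReal_norm] using hPc
  -- The retraction doubles the error, so a quarter of the gap leaves half of it to spare.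
  obtain ⟨g, hgs, hgd, hgc, hgi⟩ := hψint.exists_hasCompactSupport_integral_sub_le
    (ε := (μ.pairing ψ - c.toReal) / 4) (by linarith)
  have hφc : Continuous fun x => unitBallRetraction (g x) := continuous_unitBallRetraction.comp hgc
  have hφs : HasCompactSupport fun x => unitBallRetraction (g x) :=
    hgs.comp_left (g := unitBallRetraction) (by simp [unitBallRetraction])
  refine ⟨fun x => unitBallRetraction (g x), hφc, hφs,
    fun x => norm_unitBallRetraction_le _, ?_⟩
  have hφi := μ.integrable_of_continuous hφc hφs
  have key : |μ.pairing (ψ - fun x => unitBallRetraction (g x))| ≤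
      2 * ∫ x, ‖ψ x - g x‖ ∂(VectorMeasure.variation μ) := by
    refine (μ.abs_pairing_le _).trans ?_
    rw [← integral_const_mul]
    refine integral_mono (hψint.sub hφi).norm ((hψint.sub hgi).norm.const_mul 2) fun x => ?_
    have h1 := norm_sub_unitBallRetraction_le (x := g x) (hψ1 x)
    have h2 := norm_sub_le_norm_sub_add_norm_sub (ψ x) (g x) (unitBallRetraction (g x))
    simp only [Pi.sub_apply]
    linarith
  rw [μ.pairing_sub hψint hφi] at key
  have := (abs_le.1 key).2
  linarith

theorem Charge.variation_le_of_pairing_le (μ : Charge n) (η : Measure (Rn n)) [IsFiniteMeasure η]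
    (h : ∀ φ : Rn n → Rn n, Continuous φ → HasCompactSupport φ →
      |μ.pairing φ| ≤ ∫ x, ‖φ x‖ ∂η) :
    VectorMeasure.variation μ ≤ η := by
  refine VectorMeasure.variation_le_of_forall_enorm_le fun E hE => ?_
  rw [← ofReal_norm, ENNReal.ofReal_le_iff_le_toReal (measure_ne_top _ _)]
  refine le_of_forall_pos_le_add fun ε hε => ?_
  let e : Rn n := ‖μ E‖⁻¹ • μ E
  have he : ‖e‖ ≤ 1 := by
    rw [norm_smul, norm_inv, norm_norm]
    exact inv_mul_le_one
  let ψ : Rn n → Rn n := E.indicator fun _ => e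
  -- Working in L¹ of the sum makes one approximant good for both measures.
  have hψ : Integrable ψ (VectorMeasure.variation μ + η) := (integrable_const _).indicator hE
  have hψμ := hψ.left_of_add_measure
  have hψη := hψ.right_of_add_measure
  have hp : μ.pairing ψ = ‖μ E‖ := by
    rw [μ.pairing_indicator hE, real_inner_smul_left, real_inner_self_eq_norm_sq]
    by_cases h0 : ‖μ E‖ = 0
    · simp [h0]
    · field_simp
  obtain ⟨g, hgs, hgd, hgc, hgi⟩ := hψ.exists_hasCompactSupport_integral_sub_le hε
  have hgμ := hgi.left_of_add_measure
  have hgη := hgi.right_of_add_measure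
  replace hgd := (integral_add_measure (hψμ.sub hgμ).norm (hψη.sub hgη).norm).symm.trans_le hgd
  simp only [Pi.sub_apply] at hgd
  have h1 := μ.abs_pairing_le (ψ - g)
  rw [μ.pairing_sub hψμ hgμ, hp] at h1
  have h2 := h g hgc hgs
  have h3 : ∫ x, ‖g x‖ ∂η ≤ ∫ x, ‖ψ x‖ ∂η + ∫ x, ‖ψ x - g x‖ ∂η := by
    refine le_of_le_of_eq ?_ (integral_add hψη.norm (hψη.sub hgη).norm)
    refine integral_mono hgη.norm (hψη.norm.add (hψη.sub hgη).norm) fun x => ?_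
    have := norm_sub_norm_le (g x) (ψ x)
    rw [norm_sub_rev] at this
    linarith
  have h4 : ∫ x, ‖ψ x‖ ∂η ≤ (η E).toReal := by
    have : ∫ x, E.indicator (fun _ => (1 : ℝ)) x ∂η = (η E).toReal :=
      integral_indicator_one hE
    rw [← this]
    refine integral_mono hψη.norm ((integrable_const _).indicator hE) fun x => ?_
    by_cases hx : x ∈ E <;> simp [ψ, hx, he]
  have h5 := (abs_le.1 h1).2
  have h6 := (abs_le.1 h2).2
  simp only [Pi.sub_apply] at h5
  linarith

/-! ### Lebesgue measure on the interval and the charge of a curve -/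

theorem measurableEmbedding_coe_Icc :
    MeasurableEmbedding (Subtype.val : Icc (0 : ℝ) ℓ → ℝ) :=
  MeasurableEmbedding.subtype_coe measurableSet_Icc

theorem lebesgue_univ : lebesgue ℓ univ = ENNReal.ofReal ℓ := by
  rw [lebesgue, measurableEmbedding_coe_Icc.comap_apply, image_univ, Subtype.range_coe]
  simp

instance : IsFiniteMeasure (lebesgue ℓ) := ⟨by simp [lebesgue_univ]⟩

theorem ae_lebesgue_mem_Ioo : ∀ᵐ t ∂lebesgue ℓ, t.1 ∈ Ioo 0 ℓ := by
  rw [ae_iff, lebesgue, measurableEmbedding_coe_Icc.comap_apply]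
  refine measure_mono_null (t := {0, ℓ}) ?_ ((Set.toFinite _).measure_zero _)
  rintro _ ⟨x, hx, rfl⟩
  have h1 := x.2.1
  have h2 := x.2.2
  simp only [mem_ofPred_eq, mem_Ioo, not_and_or, not_lt] at hx
  rcases hx with h | h
  · exact Or.inl (le_antisymm h h1)
  · exact Or.inr (le_antisymm h2 h)

/-- The extension of a curve to the real line by its end points. -/
def Curve.extend (hℓ : 0 ≤ ℓ) (γ : Curve n ℓ) : ℝ → Rn n := IccExtend hℓ γ.1

theorem Curve.extend_lipschitz (hℓ : 0 ≤ ℓ) (γ : Curve n ℓ) :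
    LipschitzWith 1 (γ.extend hℓ) := by
  have := γ.2.comp (LipschitzWith.projIcc hℓ)
  rwa [mul_one] at this

/-- Trades the extension by zero, which may jump at the end points, for a globally Lipschitz one. -/
theorem Curve.velocity_eq_deriv_extend (hℓ : 0 ≤ ℓ) (γ : Curve n ℓ) {t : Icc (0 : ℝ) ℓ}
    (ht : t.1 ∈ Ioo 0 ℓ) : γ.velocity t = deriv (γ.extend hℓ) t := by
  refine Filter.EventuallyEq.deriv_eq ?_
  filter_upwards [Icc_mem_nhds ht.1 ht.2] with s hs
  rw [Curve.extend, IccExtend_of_mem hℓ _ hs]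
  exact Subtype.val_injective.extend_apply _ _ (⟨s, hs⟩ : Icc (0 : ℝ) ℓ)

theorem Curve.norm_velocity_le (γ : Curve n ℓ) : ∀ᵐ t ∂lebesgue ℓ, ‖γ.velocity t‖ ≤ 1 := by
  filter_upwards [ae_lebesgue_mem_Ioo] with t ht
  have hℓ : 0 ≤ ℓ := t.2.1.trans t.2.2
  rw [γ.velocity_eq_deriv_extend hℓ ht]
  simpa using norm_deriv_le_of_lipschitz (γ.extend_lipschitz hℓ)

/-- The vector measure `γ̇ · λ¹` on `[0,ℓ]`. -/
def Curve.velocityMeasure (γ : Curve n ℓ) : VectorMeasure (Icc (0 : ℝ) ℓ) (Rn n) :=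
  (lebesgue ℓ).withDensityᵥ γ.velocity

theorem Curve.variation_velocityMeasure (γ : Curve n ℓ) :
    γ.velocityMeasure.variation = (lebesgue ℓ).withDensity fun t => ‖γ.velocity t‖ₑ :=
  Measure.variation_withDensityᵥ γ.integrable_velocity

theorem Curve.variation_velocityMeasure_le (γ : Curve n ℓ) :
    γ.velocityMeasure.variation ≤ lebesgue ℓ := by
  rw [γ.variation_velocityMeasure]
  conv_rhs => rw [← withDensity_one (μ := lebesgue ℓ)]
  refine withDensity_mono ?_
  filter_upwards [γ.norm_velocity_le] with t ht
  change ‖_‖ₑ ≤ (1 : ℝ≥0∞)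
  rw [← ofReal_norm]
  exact ENNReal.ofReal_le_one.2 ht

theorem Curve.variation_charge_le (γ : Curve n ℓ) :
    VectorMeasure.variation γ.charge ≤ (lebesgue ℓ).map γ.1 :=
  VectorMeasure.variation_map_le.trans
    (Measure.map_mono γ.variation_velocityMeasure_le γ.1.continuous.measurable)

theorem Curve.totalVar_charge_le_length (γ : Curve n ℓ) : γ.charge.totalVar ≤ γ.length := by
  refine (VectorMeasure.variation_map_le univ).trans ?_
  rw [Measure.map_apply γ.1.continuous.measurable MeasurableSet.univ, preimage_univ]
  refine (congrArg (fun m : Measure _ => m univ) γ.variation_velocityMeasure).le.trans ?_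
  rw [withDensity_apply _ MeasurableSet.univ, Measure.restrict_univ, Curve.length]

theorem Curve.length_le (γ : Curve n ℓ) : γ.length ≤ ENNReal.ofReal ℓ := by
  rw [← lebesgue_univ, ← lintegral_one]
  refine lintegral_mono_ae ?_
  filter_upwards [γ.norm_velocity_le] with t ht
  rw [← ofReal_norm]
  exact ENNReal.ofReal_le_one.2 ht

theorem Curve.variation_charge_eq_of_totalVar_eq (γ : Curve n ℓ)
    (h : γ.charge.totalVar = ENNReal.ofReal ℓ) :
    VectorMeasure.variation γ.charge = (lebesgue ℓ).map γ.1 := by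
  refine Measure.eq_of_le_of_measure_univ_eq γ.variation_charge_le ?_
  rw [Measure.map_apply γ.1.continuous.measurable MeasurableSet.univ, preimage_univ, lebesgue_univ]
  exact h

theorem Curve.velocityMeasure_Ioc (hℓ : 0 ≤ ℓ) (γ : Curve n ℓ) {a b : ℝ} (ha : 0 ≤ a)
    (hab : a ≤ b) (hb : b ≤ ℓ) :
    γ.velocityMeasure (Subtype.val ⁻¹' Ioc a b) = γ.extend hℓ b - γ.extend hℓ a := by
  have hm : MeasurableSet ((Subtype.val : Icc (0 : ℝ) ℓ → ℝ) ⁻¹' Ioc a b) :=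
    measurable_subtype_coe measurableSet_Ioc
  have hsub : Ioc a b ⊆ Icc 0 ℓ := fun t ht => ⟨ha.trans ht.1.le, ht.2.trans hb⟩
  have h1 : γ.velocityMeasure (Subtype.val ⁻¹' Ioc a b) =
      ∫ t in a..b, deriv (γ.extend hℓ) t := by
    rw [velocityMeasure, withDensityᵥ_apply γ.integrable_velocity hm,
      intervalIntegral.integral_of_le hab]
    have h2 : ∫ t in Subtype.val ⁻¹' Ioc a b, γ.velocity t ∂lebesgue ℓ =
        ∫ t in Subtype.val ⁻¹' Ioc a b, deriv (γ.extend hℓ) t.1 ∂lebesgue ℓ := by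
      refine integral_congr_ae (ae_restrict_of_ae ?_)
      filter_upwards [ae_lebesgue_mem_Ioo] with t ht using γ.velocity_eq_deriv_extend hℓ ht
    rw [h2, lebesgue, ← measurableEmbedding_coe_Icc.setIntegral_map,
      measurableEmbedding_coe_Icc.map_comap, Measure.restrict_restrict measurableSet_Ioc,
      Subtype.range_coe, inter_eq_left.2 hsub]
  rw [h1]
  -- The fundamental theorem for absolutely continuous functions is applied to the scalar functions
  -- ⟨c,γ⟩.
  refine ext_inner_left ℝ fun c => ?_
  have hlip := γ.extend_lipschitz hℓ
  have hint : IntervalIntegrable (deriv (γ.extend hℓ)) volume a b := by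
    refine (intervalIntegrable_const (c := (1 : ℝ))).mono_fun
      (measurable_deriv _).aestronglyMeasurable (Filter.Eventually.of_forall fun t => ?_)
    simpa using norm_deriv_le_of_lipschitz hlip
  have h3 := ((innerSL ℝ c).intervalIntegral_comp_comm hint).symm
  have hcl : LipschitzWith (‖innerSL ℝ c‖₊ * 1) (fun t => innerSL ℝ c (γ.extend hℓ t)) :=
    (innerSL ℝ c).lipschitz.comp hlip
  have h4 := (hcl.lipschitzOnWith (s := uIcc a b)).absolutelyContinuousOnInterval
    |>.integral_deriv_eq_sub
  simp only [innerSL_apply_apply] at h3 h4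
  rw [h3, inner_sub_right, ← h4]
  refine intervalIntegral.integral_congr_ae ?_
  filter_upwards [hlip.ae_differentiableAt] with t ht _
  exact ((innerSL ℝ c).hasFDerivAt.comp_hasDerivAt t ht.hasDerivAt).deriv.symm

theorem Curve.pairing_charge (γ : Curve n ℓ) {φ : Rn n → Rn n} (hφ : Continuous φ) :
    γ.charge.pairing φ = γ.velocityMeasure.integral (fun t => φ (γ.1 t)) (innerSL ℝ) := by
  have hfin : IsFiniteMeasure γ.velocityMeasure.variation :=
    isFiniteMeasure_of_le _ γ.variation_velocityMeasure_le
  have hi : Integrable (φ ∘ γ.1) γ.velocityMeasure.variation :=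
    (hφ.comp γ.1.continuous).integrable_of_hasCompactSupport
      (HasCompactSupport.of_compactSpace _)
  exact VectorMeasure.integral_map (B := innerSL ℝ) γ.1.continuous.measurable
    hφ.aestronglyMeasurable hi

/-- On each of the `N` intervals φ∘γ is frozen at the left end; γ moves by at most ℓ/N there, and
its velocity measure has mass at most ℓ. The sum sees γ only at finitely many times and no longer
involves velocities. -/
theorem Curve.abs_pairing_sub_riemannSum_le (hℓ : 0 ≤ ℓ) (γ : Curve n ℓ) {φ : Rn n → Rn n}
    (hφ : Continuous φ) {N : ℕ} (hN : 0 < N) {e : ℝ} (he : 0 ≤ e)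
    (hmod : ∀ x y, dist x y ≤ ℓ / N → ‖φ x - φ y‖ ≤ e) :
    |γ.charge.pairing φ - ∑ j ∈ Finset.range N, inner ℝ (φ (γ.extend hℓ (j * (ℓ / N))))
      (γ.extend hℓ ((j + 1 : ℕ) * (ℓ / N)) - γ.extend hℓ (j * (ℓ / N)))| ≤ ℓ * e := by
  set h : ℝ := ℓ / N with hh
  have hN' : (0 : ℝ) < N := by exact_mod_cast hN
  have h0 : 0 ≤ h := by positivity
  have hNh : N * h = ℓ := by rw [hh]; field_simp
  have hfin : IsFiniteMeasure γ.velocityMeasure.variation :=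
    isFiniteMeasure_of_le _ γ.variation_velocityMeasure_le
  let I : ℕ → Set (Icc (0 : ℝ) ℓ) := fun j => Subtype.val ⁻¹' Ioc (j * h) ((j + 1 : ℕ) * h)
  have hI : ∀ j, MeasurableSet (I j) := fun j => measurable_subtype_coe measurableSet_Ioc
  let s : Icc (0 : ℝ) ℓ → Rn n := fun t =>
    ∑ j ∈ Finset.range N, (I j).indicator (fun _ => φ (γ.extend hℓ (j * h))) t
  have hsi : ∀ j ∈ Finset.range N, Integrable ((I j).indicator fun _ => φ (γ.extend hℓ (j * h)))
      γ.velocityMeasure.variation := fun j _ => (integrable_const _).indicator (hI j)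
  have hs : Integrable s γ.velocityMeasure.variation := integrable_finsetSum _ hsi
  have hφi : Integrable (fun t => φ (γ.1 t)) γ.velocityMeasure.variation :=
    (hφ.comp γ.1.continuous).integrable_of_hasCompactSupport
      (HasCompactSupport.of_compactSpace _)
  have hsint : γ.velocityMeasure.integral s (innerSL ℝ) =
      ∑ j ∈ Finset.range N, inner ℝ (φ (γ.extend hℓ (j * h)))
      (γ.extend hℓ ((j + 1 : ℕ) * h) - γ.extend hℓ (j * h)) := by
    refine (VectorMeasure.integral_finsetSum (B := innerSL ℝ) (Finset.range N) hsi).trans ?_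
    refine Finset.sum_congr rfl fun j hj => ?_
    have hj' : ((j + 1 : ℕ) : ℝ) ≤ N := by exact_mod_cast Finset.mem_range.1 hj
    rw [VectorMeasure.integral_indicator_const _ (hI j), γ.velocityMeasure_Ioc hℓ]
    · rfl
    · positivity
    · push_cast; nlinarith
    · rw [← hNh]; gcongr
  have hae : ∀ᵐ t ∂lebesgue ℓ, ‖φ (γ.1 t) - s t‖ ≤ e := by
    filter_upwards [ae_lebesgue_mem_Ioo] with t ht
    have hℓ' : 0 < ℓ := ht.1.trans ht.2
    have hpos : 0 < h := by positivity
    -- The intervals are open on the left, so the index is the ceiling minus one.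
    obtain ⟨j, hj⟩ : ∃ j : ℕ, ⌈t.1 / h⌉₊ = j + 1 :=
      ⟨⌈t.1 / h⌉₊ - 1, (Nat.succ_pred_eq_of_pos (Nat.ceil_pos.2 (div_pos ht.1 hpos))).symm⟩
    have hj1 : t.1 ≤ (j + 1 : ℕ) * h := by
      rw [← hj, ← div_le_iff₀ hpos]
      exact Nat.le_ceil _
    have hj2 : j * h < t.1 := by
      rw [← lt_div_iff₀ hpos]
      exact Nat.lt_ceil.1 (by omega)
    have hjN : j < N := by
      have : (j : ℝ) * h < N * h := by rw [hNh]; exact hj2.trans ht.2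
      exact_mod_cast lt_of_mul_lt_mul_right this h0
    have hst : s t = φ (γ.extend hℓ (j * h)) := by
      simp only [s]
      rw [Finset.sum_eq_single_of_mem j (Finset.mem_range.2 hjN)]
      · exact indicator_of_mem (show t ∈ I j from ⟨hj2, hj1⟩) _
      · intro i _ hij
        refine indicator_of_notMem (fun hi => hij ?_) _
        have h1 : (i : ℝ) * h < (j + 1 : ℕ) * h := hi.1.trans_le hj1
        have h2 : (j : ℝ) * h < (i + 1 : ℕ) * h := hj2.trans_le hi.2
        have h3 : i < j + 1 := by exact_mod_cast lt_of_mul_lt_mul_right h1 h0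
        have h4 : j < i + 1 := by exact_mod_cast lt_of_mul_lt_mul_right h2 h0
        omega
    rw [hst]
    refine hmod _ _ ?_
    have h5 : γ.1 t = γ.extend hℓ t := (IccExtend_val hℓ _ t).symm
    rw [h5]
    refine ((γ.extend_lipschitz hℓ).dist_le_mul _ _).trans ?_
    rw [Real.dist_eq, abs_of_nonneg (by linarith)]
    push_cast at hj1 ⊢
    linarith
  have hae' : ∀ᵐ t ∂γ.velocityMeasure.variation, ‖φ (γ.1 t) - s t‖ ≤ e :=
    ae_mono γ.variation_velocityMeasure_le hae
  rw [γ.pairing_charge hφ, ← hsint, ← VectorMeasure.integral_fun_sub hφi hs]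
  refine (VectorMeasure.norm_integral_le_of_norm_le_const (μ := γ.velocityMeasure)
    (B := (innerSL ℝ : Rn n →L[ℝ] Rn n →L[ℝ] ℝ)) hae').trans ?_
  have hvar : γ.velocityMeasure.variation.real univ ≤ ℓ := by
    refine ENNReal.toReal_le_of_le_ofReal hℓ ?_
    rw [← lebesgue_univ]
    exact γ.variation_velocityMeasure_le _
  calc e * ‖(innerSL ℝ : Rn n →L[ℝ] Rn n →L[ℝ] ℝ)‖ * γ.velocityMeasure.variation.real univ
      ≤ e * 1 * ℓ := by
        gcongr
        exact norm_innerSL_le_one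
    _ = ℓ * e := by ring

/-! ### The space of curves -/

/-- The constant curve at the origin. -/
instance : Inhabited (Curve n ℓ) := ⟨⟨0, LipschitzWith.const' 0⟩⟩

/-- Arzelà–Ascoli. This gives the local compactness of K_ℓ that the Riesz theorem needs. -/
theorem Curve.isCompact_setOf_norm_le (R : ℝ) :
    IsCompact {γ : Curve n ℓ | ∀ t, ‖γ.1 t‖ ≤ R} := by
  rw [Subtype.isCompact_iff]
  let T : Set (Icc (0 : ℝ) ℓ → Rn n) := {f | LipschitzWith 1 f ∧ ∀ t, ‖f t‖ ≤ R}
  have hT : IsCompact T := by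
    refine (isCompact_univ_pi fun _ : Icc (0 : ℝ) ℓ =>
      isCompact_closedBall (0 : Rn n) R).of_isClosed_subset ?_ ?_
    · refine IsClosed.inter ?_ ?_
      · change IsClosed {f : Icc (0 : ℝ) ℓ → Rn n | LipschitzWith 1 f}
        simp only [lipschitzWith_iff_dist_le_mul, ofPred_forall]
        exact isClosed_iInter fun x => isClosed_iInter fun y =>
          isClosed_le (by fun_prop) continuous_const
      · change IsClosed {f : Icc (0 : ℝ) ℓ → Rn n | ∀ t, ‖f t‖ ≤ R}
        simp only [ofPred_forall]
        exact isClosed_iInter fun x => isClosed_le (by fun_prop) continuous_const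
    · intro f hf t _
      simpa using hf.2 t
  refine ArzelaAscoli.isCompact_of_equicontinuous _ ?_ ?_
  · convert hT using 1
    ext f
    constructor
    · rintro ⟨_, ⟨γ, hγ, rfl⟩, rfl⟩
      exact ⟨γ.2, hγ⟩
    · rintro ⟨h1, h2⟩
      exact ⟨⟨f, h1.continuous⟩, ⟨⟨⟨f, h1.continuous⟩, h1⟩, h2, rfl⟩, rfl⟩
  · refine (LipschitzWith.uniformEquicontinuous _ 1 ?_).equicontinuous
    rintro ⟨_, ⟨γ, hγ, rfl⟩⟩
    exact γ.2

instance : LocallyCompactSpace (Curve n ℓ) := by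
  have : WeaklyLocallyCompactSpace (Curve n ℓ) := by
    refine ⟨fun γ => ⟨{γ' | ∀ t, ‖γ'.1 t‖ ≤ ‖γ.1‖ + 1}, Curve.isCompact_setOf_norm_le _, ?_⟩⟩
    filter_upwards [Metric.ball_mem_nhds γ one_pos] with γ' hγ' t
    have h1 : ‖γ'.1 - γ.1‖ < 1 := by rwa [← dist_eq_norm]
    have h2 := γ'.1.norm_coe_le_norm t
    have h3 := norm_sub_norm_le γ'.1 γ.1
    linarith
  infer_instance

theorem Curve.dist_apply_le (γ : Curve n ℓ) (s t : Icc (0 : ℝ) ℓ) : dist (γ.1 s) (γ.1 t) ≤ ℓ := by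
  refine (γ.2.dist_le_mul s t).trans ?_
  rw [NNReal.coe_one, one_mul, Subtype.dist_eq, Real.dist_eq, abs_le]
  constructor <;> linarith [s.2.1, s.2.2, t.2.1, t.2.2]

theorem Curve.abs_pairing_charge_le (γ : Curve n ℓ) {φ : Rn n → Rn n} (hφ : Continuous φ)
    (hs : HasCompactSupport φ) :
    |γ.charge.pairing φ| ≤ ∫ t, ‖φ (γ.1 t)‖ ∂lebesgue ℓ := by
  refine (γ.charge.abs_pairing_le φ).trans ?_
  have hm := γ.1.continuous.measurable
  rw [← integral_map (f := fun x => ‖φ x‖) hm.aemeasurable hφ.norm.aestronglyMeasurable]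
  have : IsFiniteMeasure ((lebesgue ℓ).map γ.1) := inferInstance
  exact integral_mono_measure γ.variation_charge_le
    (Filter.Eventually.of_forall fun _ => norm_nonneg _)
    (hφ.integrable_of_hasCompactSupport hs).norm

theorem exists_pos_modulus {φ : Rn n → Rn n} (hφ : Continuous φ) (hs : HasCompactSupport φ)
    {e : ℝ} (he : 0 < e) : ∃ δ > 0, ∀ x y, dist x y ≤ δ → ‖φ x - φ y‖ ≤ e := by
  obtain ⟨δ, hδ, h⟩ := Metric.uniformContinuous_iff.1
    (hs.uniformContinuous_of_continuous hφ) e he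
  refine ⟨δ / 2, by positivity, fun x y hxy => ?_⟩
  rw [← dist_eq_norm]
  exact (h (hxy.trans_lt (by linarith))).le

theorem exists_nat_div_le (ℓ : ℝ) {δ : ℝ} (hδ : 0 < δ) : ∃ N : ℕ, 0 < N ∧ ℓ / N ≤ δ := by
  obtain ⟨N, hN⟩ := exists_nat_gt (ℓ / δ)
  refine ⟨N + 1, N.succ_pos, ?_⟩
  rw [div_le_comm₀ (by positivity) hδ]
  push_cast
  linarith

/-- Velocities are not continuous under uniform convergence, but the pairing is a uniform limit of
Riemann sums, which are. -/
theorem Curve.continuous_pairing (hℓ : 0 ≤ ℓ) {φ : Rn n → Rn n} (hφ : Continuous φ)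
    (hs : HasCompactSupport φ) : Continuous fun γ : Curve n ℓ => γ.charge.pairing φ := by
  refine continuous_of_uniform_approx_of_continuous fun u hu => ?_
  obtain ⟨ε, hε, hu⟩ := Metric.mem_uniformity_dist.1 hu
  have he : 0 < ε / (ℓ + 1) := by positivity
  obtain ⟨δ, hδ, hmod⟩ := exists_pos_modulus hφ hs he
  obtain ⟨N, hN, hNδ⟩ := exists_nat_div_le ℓ hδ
  refine ⟨fun γ => ∑ j ∈ Finset.range N, inner ℝ (φ (γ.extend hℓ (j * (ℓ / N))))
      (γ.extend hℓ ((j + 1 : ℕ) * (ℓ / N)) - γ.extend hℓ (j * (ℓ / N))), ?_, fun γ => hu ?_⟩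
  · have hev : ∀ t : ℝ, Continuous fun γ : Curve n ℓ => γ.extend hℓ t := fun t =>
      (continuous_eval_const (F := C(Icc (0 : ℝ) ℓ, Rn n)) (projIcc 0 ℓ hℓ t)).comp continuous_subtype_val
    exact continuous_finsetSum _ fun j _ =>
      (hφ.comp (hev _)).inner ((hev _).sub (hev _))
  · rw [Real.dist_eq]
    refine (γ.abs_pairing_sub_riemannSum_le hℓ hφ hN he.le
      fun x y hxy => hmod x y (hxy.trans hNδ)).trans_lt ?_
    rw [mul_div_assoc', div_lt_iff₀ (by positivity)]
    nlinarith

/-- A curve that meets a ball of radius `R` about the origin stays within radius `R + ℓ`. -/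
theorem Curve.hasCompactSupport_pairing {φ : Rn n → Rn n} (hφ : Continuous φ)
    (hs : HasCompactSupport φ) :
    HasCompactSupport fun γ : Curve n ℓ => γ.charge.pairing φ := by
  obtain ⟨R, hR⟩ := hs.isBounded.subset_closedBall 0
  refine HasCompactSupport.intro (Curve.isCompact_setOf_norm_le (R + ℓ)) fun γ hγ => ?_
  have h0 : ∀ t, φ (γ.1 t) = 0 := by
    intro t
    by_contra ht
    refine hγ fun s => ?_
    have h1 : ‖γ.1 t‖ ≤ R := by simpa using hR (subset_tsupport φ ht)
    have h2 := γ.dist_apply_le s t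
    rw [dist_eq_norm] at h2
    have h3 := norm_sub_norm_le (γ.1 s) (γ.1 t)
    linarith
  have := γ.abs_pairing_charge_le hφ hs
  simpa [h0] using this

/-- Polygonal curves with prescribed velocities of norm at most one. -/
theorem Curve.exists_polygon (hℓ : 0 ≤ ℓ) {N : ℕ} (hN : 0 < N) (x : Rn n) (w : ℕ → Rn n)
    (hw : ∀ i, ‖w i‖ ≤ 1) :
    ∃ γ : Curve n ℓ, ∀ j ≤ N,
      γ.extend hℓ (j * (ℓ / N)) = x + (ℓ / N) • ∑ i ∈ Finset.range j, w i := by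
  have hN' : (0 : ℝ) < N := by exact_mod_cast hN
  set h : ℝ := ℓ / N with hh
  have h0 : 0 ≤ h := by positivity
  have hNh : N * h = ℓ := by rw [hh]; field_simp
  -- For `t ≥ 0` this is the time spent in step `i` up to `t`; over all steps these times telescope
  -- to `t`.
  let a : ℕ → ℝ → ℝ := fun i t => min t ((i + 1 : ℕ) * h) - min t (i * h)
  have ha : ∀ i s t, s ≤ t → a i s ≤ a i t := by
    intro i s t hst
    have : (i : ℝ) * h ≤ (i + 1 : ℕ) * h := by push_cast; nlinarith
    simp only [a]
    rcases le_total s (i * h) with h1 | h1 <;> rcases le_total s ((i + 1 : ℕ) * h) with h2 | h2 <;>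
    rcases le_total t (i * h) with h3 | h3 <;> rcases le_total t ((i + 1 : ℕ) * h) with h4 | h4 <;>
    simp only [h1, h2, h3, h4, min_eq_left, min_eq_right] <;> linarith
  have hsum : ∀ t ∈ Icc 0 ℓ, ∑ i ∈ Finset.range N, a i t = t := by
    intro t ht
    rw [Finset.sum_range_sub fun i : ℕ => min t (i * h)]
    simp [hNh, ht.1, ht.2]
  let f : ℝ → Rn n := fun t => x + ∑ i ∈ Finset.range N, a i t • w i
  have hf : ∀ s ∈ Icc 0 ℓ, ∀ t ∈ Icc 0 ℓ, s ≤ t → ‖f t - f s‖ ≤ t - s := by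
    intro s hs t ht hst
    have : f t - f s = ∑ i ∈ Finset.range N, (a i t - a i s) • w i := by
      simp only [f, add_sub_add_left_eq_sub, sub_smul, Finset.sum_sub_distrib]
    rw [this]
    calc ‖∑ i ∈ Finset.range N, (a i t - a i s) • w i‖
        ≤ ∑ i ∈ Finset.range N, (a i t - a i s) := by
          refine norm_sum_le_of_le _ fun i _ => ?_
          rw [norm_smul, Real.norm_of_nonneg (sub_nonneg.2 (ha i s t hst))]
          exact mul_le_of_le_one_right (sub_nonneg.2 (ha i s t hst)) (hw i)
      _ = t - s := by rw [Finset.sum_sub_distrib, hsum t ht, hsum s hs]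
  have hlip : LipschitzWith 1 fun t : Icc (0 : ℝ) ℓ => f t := by
    refine LipschitzWith.of_dist_le_mul fun s t => ?_
    rw [NNReal.coe_one, one_mul, Subtype.dist_eq, Real.dist_eq]
    rcases le_total s.1 t.1 with hst | hst
    · rw [dist_comm, dist_eq_norm, abs_sub_comm, abs_of_nonneg (sub_nonneg.2 hst)]
      exact hf _ s.2 _ t.2 hst
    · rw [dist_eq_norm, abs_of_nonneg (sub_nonneg.2 hst)]
      exact hf _ t.2 _ s.2 hst
  refine ⟨⟨⟨fun t => f t, hlip.continuous⟩, hlip⟩, fun j hj => ?_⟩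
  have hj' : (j : ℝ) ≤ N := by exact_mod_cast hj
  have hmem : (j : ℝ) * h ∈ Icc 0 ℓ := ⟨by positivity, by rw [← hNh]; gcongr⟩
  rw [Curve.extend, IccExtend_of_mem hℓ _ hmem]
  change x + ∑ i ∈ Finset.range N, a i (j * h) • w i = _
  have hval : ∀ i, a i (j * h) = if i < j then h else 0 := by
    intro i
    simp only [a]
    split_ifs with hij
    · have h1 : ((i + 1 : ℕ) : ℝ) * h ≤ j * h := by gcongr; exact hij
      have h2 : (i : ℝ) * h ≤ j * h := by gcongr
      rw [min_eq_right h1, min_eq_right h2]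
      push_cast
      ring
    · have hij' : j ≤ i := not_lt.1 hij
      have h1 : (j : ℝ) * h ≤ (i + 1 : ℕ) * h := by gcongr; omega
      have h2 : (j : ℝ) * h ≤ i * h := by gcongr
      rw [min_eq_left h1, min_eq_left h2, sub_self]
  congr 1
  simp only [hval, ite_smul, zero_smul]
  rw [← Finset.sum_filter, Finset.smul_sum]
  congr 1
  ext i
  simp only [Finset.mem_filter, Finset.mem_range]
  omega

/-! ### Mollification -/

/-- The convolution of a function with a normalized bump function. -/
def mollify (ρ : ContDiffBump (0 : Rn n)) (u : Rn n → ℝ) : Rn n → ℝ :=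
  convolution (ρ.normed volume) u (ContinuousLinearMap.lsmul ℝ ℝ) volume

section mollify

variable (ρ : ContDiffBump (0 : Rn n)) {u v : Rn n → ℝ}

theorem mollify_apply (u : Rn n → ℝ) (x : Rn n) :
    mollify ρ u x = ∫ t, ρ.normed volume t * u (x - t) := rfl

theorem integrable_normed_mul {g : Rn n → ℝ} (hg : Continuous g) :
    Integrable (fun t => ρ.normed volume t * g t) (volume : Measure (Rn n)) :=
  (ρ.continuous_normed.mul hg).integrable_of_hasCompactSupport
    ρ.hasCompactSupport_normed.mul_right

theorem integrable_normed_mul_sub (hu : Continuous u) (x : Rn n) :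
    Integrable (fun t => ρ.normed volume t * u (x - t)) (volume : Measure (Rn n)) :=
  integrable_normed_mul ρ (hu.comp (continuous_const.sub continuous_id))

theorem contDiff_mollify (hu : Continuous u) : ContDiff ℝ (⊤ : ℕ∞) (mollify ρ u) :=
  ρ.hasCompactSupport_normed.contDiff_convolution_left _ ρ.contDiff_normed hu.locallyIntegrable

theorem hasCompactSupport_mollify (hs : HasCompactSupport u) :
    HasCompactSupport (mollify ρ u) :=
  ρ.hasCompactSupport_normed.convolution _ hs

theorem mollify_le (hu : Continuous u) {C : ℝ} (h : ∀ x, u x ≤ C) (x : Rn n) :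
    mollify ρ u x ≤ C := by
  have h1 : ∫ t, ρ.normed volume t * C = C := by
    rw [integral_mul_const, ρ.integral_normed, one_mul]
  rw [← h1, mollify_apply]
  exact integral_mono (integrable_normed_mul_sub ρ hu x) (integrable_normed_mul ρ continuous_const)
    fun t => mul_le_mul_of_nonneg_left (h _) (ρ.nonneg_normed t)

theorem le_mollify_sub_mollify (hu : Continuous u) (hv : Continuous v) (x y : Rn n) {c : ℝ}
    (h : ∀ t, ‖t‖ ≤ ρ.rOut → c ≤ u (x - t) - v (y - t)) :
    c ≤ mollify ρ u x - mollify ρ v y := by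
  have h1 : ∫ t, ρ.normed volume t * c = c := by
    rw [integral_mul_const, ρ.integral_normed, one_mul]
  rw [← h1, mollify_apply, mollify_apply, ← integral_sub (integrable_normed_mul_sub ρ hu x)
    (integrable_normed_mul_sub ρ hv y)]
  refine integral_mono (integrable_normed_mul ρ continuous_const)
    ((integrable_normed_mul_sub ρ hu x).sub (integrable_normed_mul_sub ρ hv y)) fun t => ?_
  by_cases ht : t ∈ Metric.ball 0 ρ.rOut
  · change _ ≤ _ * _ - _ * _
    rw [← mul_sub]
    exact mul_le_mul_of_nonneg_left (h t (by simpa using (Metric.mem_ball.1 ht).le))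
      (ρ.nonneg_normed t)
  · have hsupp : Function.support (ρ.normed (volume : Measure (Rn n))) = Metric.ball 0 ρ.rOut :=
      ρ.support_normed_eq
    have h0 : ρ.normed volume t = 0 := Function.notMem_support.1 (hsupp ▸ ht)
    simp only [h0, zero_mul, sub_zero, le_refl]

theorem hasFDerivAt_mollify (hu : Continuous u) (x : Rn n) :
    HasFDerivAt (mollify ρ u) (∫ t, u (x - t) • fderiv ℝ (ρ.normed volume) t) x := by
  have := (ρ.hasCompactSupport_normed (μ := volume)).hasFDerivAt_convolution_left (μ := volume)
    (ContinuousLinearMap.lsmul ℝ ℝ) ρ.contDiff_normed hu.locallyIntegrable x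
  have h1 : ∫ t, u (x - t) • fderiv ℝ (ρ.normed volume) t =
      convolution (fderiv ℝ (ρ.normed volume)) u
        (ContinuousLinearMap.precompL (Rn n) (ContinuousLinearMap.lsmul ℝ ℝ)) volume x := by
    rw [convolution_def]
    congr 1 with t y
    simp [ContinuousLinearMap.precompL_apply, mul_comm]
  rw [h1]
  exact this

/-- The mass of the derivative of a normalized bump function. -/
def derivMass : ℝ := ∫ t, ‖fderiv ℝ (ρ.normed volume) t‖

theorem derivMass_nonneg : 0 ≤ derivMass ρ := integral_nonneg fun _ => norm_nonneg _

theorem continuous_fderiv_normed :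
    Continuous (fderiv ℝ (ρ.normed (volume : Measure (Rn n)))) :=
  (ρ.contDiff_normed (n := 1)).continuous_fderiv (by simp)

/-- The derivative falls on the kernel, so the oscillation of `u` alone controls that of the
gradient, at a cost depending only on `ρ`. -/
theorem norm_fderiv_mollify_sub_le (hu : Continuous u) {h m : ℝ}
    (hmod : ∀ x y, dist x y ≤ h → |u x - u y| ≤ m) {x y : Rn n} (hxy : dist x y ≤ h) :
    ‖fderiv ℝ (mollify ρ u) x - fderiv ℝ (mollify ρ u) y‖ ≤ m * derivMass ρ := by
  have hc := continuous_fderiv_normed ρ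
  have hcs := ρ.hasCompactSupport_normed (μ := volume) |>.fderiv ℝ
  have hi : ∀ z, Integrable (fun t => u (z - t) • fderiv ℝ (ρ.normed volume) t)
      (volume : Measure (Rn n)) := fun z =>
    ((hu.comp (continuous_const.sub continuous_id)).smul hc).integrable_of_hasCompactSupport
      hcs.smul_left
  rw [(hasFDerivAt_mollify ρ hu x).fderiv, (hasFDerivAt_mollify ρ hu y).fderiv,
    ← integral_sub (hi x) (hi y), derivMass, ← integral_const_mul]
  refine norm_integral_le_of_norm_le
    ((hc.integrable_of_hasCompactSupport hcs).norm.const_mul m)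
    (Filter.Eventually.of_forall fun t => ?_)
  rw [← sub_smul, norm_smul]
  refine mul_le_mul_of_nonneg_right (hmod _ _ ?_) (norm_nonneg _)
  rwa [dist_sub_right]

theorem abs_mollify_sub_sub_fderiv_le (hu : Continuous u) {h m : ℝ}
    (hmod : ∀ x y, dist x y ≤ h → |u x - u y| ≤ m) (x v : Rn n) (hv : ‖v‖ ≤ h) :
    |mollify ρ u (x + v) - mollify ρ u x - fderiv ℝ (mollify ρ u) x v| ≤
      m * derivMass ρ * ‖v‖ := by
  have hd : ∀ z, HasFDerivAt (mollify ρ u) (fderiv ℝ (mollify ρ u) z) z := fun z =>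
    (hasFDerivAt_mollify ρ hu z).differentiableAt.hasFDerivAt
  have := Convex.norm_image_sub_le_of_norm_hasFDerivWithin_le' (f := mollify ρ u) (𝕜 := ℝ)
    (s := Metric.closedBall x h) (x := x) (y := x + v) (C := m * derivMass ρ)
    (φ := fderiv ℝ (mollify ρ u) x) (fun z _ => (hd z).hasFDerivWithinAt)
    (fun z hz => norm_fderiv_mollify_sub_le ρ hu hmod hz) (convex_closedBall x h)
    (Metric.mem_closedBall_self ((norm_nonneg v).trans hv)) (by simpa using hv)
  simpa using this

theorem continuous_gradient_mollify (hu : Continuous u) : Continuous (∇ (mollify ρ u)) :=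
  (InnerProductSpace.toDual ℝ (Rn n)).symm.continuous.comp
    ((contDiff_mollify ρ hu).continuous_fderiv (by simp))

theorem hasCompactSupport_gradient_mollify (hs : HasCompactSupport u) :
    HasCompactSupport (∇ (mollify ρ u)) :=
  ((hasCompactSupport_mollify ρ hs).fderiv ℝ).comp_left
    (g := (InnerProductSpace.toDual ℝ (Rn n)).symm) (map_zero _)

theorem Charge.pairing_gradient_mollify {μ : Charge n} (hμ : μ.div = 0) (hu : Continuous u)
    (hs : HasCompactSupport u) : μ.pairing (∇ (mollify ρ u)) = 0 := by
  have := congrFun hμ ⟨mollify ρ u, contDiff_mollify ρ hu, hasCompactSupport_mollify ρ hs,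
    by simp⟩
  simpa [Charge.div] using this

/-- If `u` dominates the one-step update of `v` along every direction, then the field tested
against a divergence-free charge is bounded by the increment of the mollified functions. -/
theorem Charge.mul_pairing_le_of_step {μ : Charge n} (hμ : μ.div = 0) {φ : Rn n → Rn n}
    (hφ : Continuous φ) (hφs : HasCompactSupport φ) (hu : Continuous u)
    (hus : HasCompactSupport u) (hv : Continuous v) (hvs : HasCompactSupport v) {h m e : ℝ}
    (h0 : 0 < h) (he : ∀ x y, dist x y ≤ ρ.rOut → ‖φ x - φ y‖ ≤ e)
    (hmod : ∀ x y, dist x y ≤ h → |v x - v y| ≤ m)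
    (hstep : ∀ x w, ‖w‖ ≤ 1 → h * inner ℝ (φ x) w + v (x + h • w) ≤ u x) :
    h * μ.pairing φ ≤ ∫ x, mollify ρ u x ∂(VectorMeasure.variation μ) -
      ∫ x, mollify ρ v x ∂(VectorMeasure.variation μ) +
      h * (e + m * derivMass ρ) * (VectorMeasure.variation μ).real univ := by
  set U := mollify ρ u
  set V := mollify ρ v
  have hm0 : 0 ≤ m := (abs_nonneg _).trans (hmod 0 0 (by simpa using h0.le))
  have he0 : 0 ≤ e := (norm_nonneg _).trans (he 0 0 (by simpa using ρ.rOut_pos.le))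
  -- The discrete Hamilton–Jacobi inequality: mollify the step inequality, linearize V at x, and
  -- choose the best direction w.
  have hpt : ∀ x, h * ‖φ x + ∇ V x‖ ≤ U x - V x + h * (e + m * derivMass ρ) := by
    intro x
    have key : ∀ w, ‖w‖ ≤ 1 →
        h * inner ℝ (φ x + ∇ V x) w ≤ U x - V x + h * (e + m * derivMass ρ) := by
      intro w hw
      have h1 : h * inner ℝ (φ x) w - h * e ≤ U x - V (x + h • w) := by
        refine le_mollify_sub_mollify ρ hu hv _ _ fun t ht => ?_
        have h2 := hstep (x - t) w hw
        rw [show x + h • w - t = x - t + h • w by abel]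
        have h3 : inner ℝ (φ x) w - e ≤ inner ℝ (φ (x - t)) w := by
          have h4 : inner ℝ (φ x - φ (x - t)) w ≤ e :=
            (real_inner_le_norm _ _).trans ((mul_le_of_le_one_right (norm_nonneg _) hw).trans
              (he _ _ (by simpa [dist_eq_norm] using ht)))
          rw [inner_sub_left] at h4
          linarith
        have h5 := mul_le_mul_of_nonneg_left h3 h0.le
        linarith
      have hn : ‖h • w‖ ≤ h := by
        rw [norm_smul, Real.norm_of_nonneg h0.le]
        exact mul_le_of_le_one_right h0.le hw
      have h6 := (abs_le.1 (abs_mollify_sub_sub_fderiv_le ρ hv hmod x (h • w) hn)).1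
      have h7 : m * derivMass ρ * ‖h • w‖ ≤ m * derivMass ρ * h :=
        mul_le_mul_of_nonneg_left hn (mul_nonneg hm0 (derivMass_nonneg ρ))
      rw [map_smul, smul_eq_mul] at h6
      rw [inner_add_left, inner_gradient_left]
      change -_ ≤ V (x + h • w) - V x - h * fderiv ℝ V x w at h6
      linarith
    set z := φ x + ∇ V x
    have h8 := key (‖z‖⁻¹ • z) (by rw [norm_smul, norm_inv, norm_norm]; exact inv_mul_le_one)
    rw [real_inner_smul_right, real_inner_self_eq_norm_sq] at h8
    convert h8 using 2
    by_cases hz : ‖z‖ = 0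
    · simp [hz]
    · field_simp
  have hUi : Integrable U (VectorMeasure.variation μ) :=
    (contDiff_mollify ρ hu).continuous.integrable_of_hasCompactSupport
      (hasCompactSupport_mollify ρ hus)
  have hVi : Integrable V (VectorMeasure.variation μ) :=
    (contDiff_mollify ρ hv).continuous.integrable_of_hasCompactSupport
      (hasCompactSupport_mollify ρ hvs)
  have hφi := μ.integrable_of_continuous hφ hφs
  have hGi := μ.integrable_of_continuous (continuous_gradient_mollify ρ hv)
    (hasCompactSupport_gradient_mollify ρ hvs)
  -- Here the vanishing divergence enters.
  have h1 : μ.pairing φ = μ.pairing (φ + ∇ V) := by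
    rw [μ.pairing_add hφi hGi, Charge.pairing_gradient_mollify ρ hμ hv hvs, add_zero]
  calc h * μ.pairing φ ≤ h * ∫ x, ‖φ x + ∇ V x‖ ∂(VectorMeasure.variation μ) := by
        rw [h1]
        exact mul_le_mul_of_nonneg_left ((le_abs_self _).trans (μ.abs_pairing_le _)) h0.le
    _ = ∫ x, h * ‖φ x + ∇ V x‖ ∂(VectorMeasure.variation μ) := (integral_const_mul _ _).symm
    _ ≤ ∫ x, (U x - V x + h * (e + m * derivMass ρ)) ∂(VectorMeasure.variation μ) :=
        integral_mono ((hφi.add hGi).norm.const_mul h)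
          ((hUi.sub hVi).add (integrable_const _)) hpt
    _ = _ := by
        refine (integral_add (hUi.sub hVi) (integrable_const _)).trans ?_
        rw [integral_sub' hUi hVi, integral_const, smul_eq_mul, mul_comm (Measure.real _ _)]

end mollify

/-! ### The discrete value function -/

/-- Sequences of velocities of norm at most one. -/
abbrev Control (n : ℕ) : Type := {w : ℕ → Rn n // ∀ i, ‖w i‖ ≤ 1}

instance : Inhabited (Control n) := ⟨⟨0, fun i => by simp⟩⟩

/-- The control that starts with the velocity `v` and continues with `w`. -/
def Control.cons (v : Rn n) (hv : ‖v‖ ≤ 1) (w : Control n) : Control n :=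
  ⟨fun i => Nat.casesOn i v w.1, fun i => by cases i <;> simp [hv, w.2]⟩

/-- The Riemann sum of the field `φ` along the polygon of `k` steps of duration `h` that starts at
`x` and has the velocities `w`. -/
def payoff (φ : Rn n → Rn n) (h : ℝ) (k : ℕ) (x : Rn n) (w : Control n) : ℝ :=
  ∑ j ∈ Finset.range k, h * inner ℝ (φ (x + h • ∑ i ∈ Finset.range j, w.1 i)) (w.1 j)

/-- The largest payoff of a polygon of `k` steps of duration `h` that starts at `x`. -/
def value (φ : Rn n → Rn n) (h : ℝ) (k : ℕ) (x : Rn n) : ℝ := ⨆ w, payoff φ h k x w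

section value

variable {φ : Rn n → Rn n} {h : ℝ}

theorem payoff_cons (k : ℕ) (x v : Rn n) (hv : ‖v‖ ≤ 1) (w : Control n) :
    payoff φ h (k + 1) x (w.cons v hv) =
      h * inner ℝ (φ x) v + payoff φ h k (x + h • v) w := by
  rw [payoff, Finset.sum_range_succ', add_comm]
  congr 1
  · simp [Control.cons]
  · refine Finset.sum_congr rfl fun j _ => ?_
    rw [Finset.sum_range_succ']
    simp only [Control.cons, smul_add]
    rw [add_comm (h • ∑ i ∈ _, _), add_assoc]
    rfl

theorem abs_payoff_le (h0 : 0 ≤ h) {C : ℝ} (hC : ∀ x, ‖φ x‖ ≤ C) (k : ℕ) (x : Rn n) (w : Control n) :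
    |payoff φ h k x w| ≤ k * (h * C) := by
  refine (Finset.abs_sum_le_sum_abs _ _).trans ?_
  refine (Finset.sum_le_card_nsmul _ _ (h * C) fun j _ => ?_).trans (by simp)
  rw [abs_mul, abs_of_nonneg h0]
  refine mul_le_mul_of_nonneg_left ((abs_real_inner_le_norm _ _).trans ?_) h0
  exact (mul_le_of_le_one_right (norm_nonneg _) (w.2 j)).trans (hC _)

/-- Ensures that the supremum in `value` is a genuine one and not the default 0. -/
theorem bddAbove_payoff (h0 : 0 ≤ h) {C : ℝ} (hC : ∀ x, ‖φ x‖ ≤ C) (k : ℕ) (x : Rn n) :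
    BddAbove (range (payoff φ h k x)) := by
  refine ⟨k * (h * C), ?_⟩
  rintro _ ⟨w, rfl⟩
  exact (abs_le.1 (abs_payoff_le h0 hC k x w)).2

theorem payoff_le_payoff_add (h0 : 0 ≤ h) {δ e : ℝ} (hmod : ∀ x y, dist x y ≤ δ → ‖φ x - φ y‖ ≤ e)
    (k : ℕ) {x y : Rn n} (hxy : dist x y ≤ δ) (w : Control n) :
    payoff φ h k x w ≤ payoff φ h k y w + k * (h * e) := by
  rw [← sub_le_iff_le_add', payoff, payoff, ← Finset.sum_sub_distrib]
  refine (Finset.sum_le_card_nsmul _ _ (h * e) fun j _ => ?_).trans (by simp)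
  rw [← mul_sub, ← inner_sub_left]
  refine mul_le_mul_of_nonneg_left ((real_inner_le_norm _ _).trans ?_) h0
  exact (mul_le_of_le_one_right (norm_nonneg _) (w.2 j)).trans
    (hmod _ _ (by rwa [dist_add_right]))

/-- The same control run from `x` and from `y` gives translated polygons, which keep their distance.
-/
theorem abs_value_sub_le (h0 : 0 ≤ h) {C : ℝ} (hC : ∀ x, ‖φ x‖ ≤ C) {δ e : ℝ}
    (hmod : ∀ x y, dist x y ≤ δ → ‖φ x - φ y‖ ≤ e) (k : ℕ) {x y : Rn n} (hxy : dist x y ≤ δ) :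
    |value φ h k x - value φ h k y| ≤ k * (h * e) := by
  have key : ∀ {x y}, dist x y ≤ δ → value φ h k x ≤ value φ h k y + k * (h * e) := by
    intro x y hxy
    exact ciSup_le fun w => (payoff_le_payoff_add h0 hmod k hxy w).trans
      (add_le_add_left (le_ciSup (bddAbove_payoff h0 hC k y) w) _)
  have h1 := key hxy
  have h2 := key (dist_comm x y ▸ hxy)
  exact abs_le.2 ⟨by linarith, by linarith⟩

theorem continuous_value (h0 : 0 ≤ h) (hφ : Continuous φ) (hs : HasCompactSupport φ) (k : ℕ) :
    Continuous (value φ h k) := by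
  obtain ⟨C, hC⟩ := hs.exists_bound_of_continuous hφ
  refine Metric.continuous_iff.2 fun x ε hε => ?_
  obtain ⟨δ, hδ, hmod⟩ := exists_pos_modulus hφ hs (e := ε / (k * h + 1)) (by positivity)
  refine ⟨δ, hδ, fun y hy => ?_⟩
  refine (abs_value_sub_le h0 hC hmod k hy.le).trans_lt ?_
  rw [← mul_assoc, mul_div_assoc', div_lt_iff₀ (by positivity)]
  nlinarith

theorem hasCompactSupport_value (h0 : 0 ≤ h) (hs : HasCompactSupport φ) (k : ℕ) :
    HasCompactSupport (value φ h k) := by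
  obtain ⟨R, hR⟩ := hs.isBounded.subset_closedBall 0
  refine HasCompactSupport.intro (isCompact_closedBall (0 : Rn n) (R + k * h)) fun x hx => ?_
  have hx' : R + k * h < ‖x‖ := by simpa using hx
  have hz : ∀ w, payoff φ h k x w = 0 := by
    intro w
    refine Finset.sum_eq_zero fun j hj => ?_
    have : φ (x + h • ∑ i ∈ Finset.range j, w.1 i) = 0 := by
      by_contra hne
      have h1 : ‖x + h • ∑ i ∈ Finset.range j, w.1 i‖ ≤ R := by
        simpa using hR (subset_tsupport φ hne)
      have h2 : ‖∑ i ∈ Finset.range j, w.1 i‖ ≤ k := by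
        refine (norm_sum_le_of_le _ fun i _ => w.2 i).trans ?_
        simpa using (Finset.mem_range.1 hj).le
      have h3 : ‖h • ∑ i ∈ Finset.range j, w.1 i‖ ≤ k * h := by
        rw [norm_smul, Real.norm_of_nonneg h0, mul_comm]
        gcongr
      have h4 := norm_sub_le (x + h • ∑ i ∈ Finset.range j, w.1 i)
        (h • ∑ i ∈ Finset.range j, w.1 i)
      rw [add_sub_cancel_right] at h4
      linarith
    rw [this, inner_zero_left, mul_zero]
  simp [value, hz]

/-- The half of the dynamic programming principle that is needed: prepend `v` to any control. -/
theorem le_value_succ (h0 : 0 ≤ h) {C : ℝ} (hC : ∀ x, ‖φ x‖ ≤ C) (k : ℕ) (x v : Rn n) (hv : ‖v‖ ≤ 1) :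
    h * inner ℝ (φ x) v + value φ h k (x + h • v) ≤ value φ h (k + 1) x := by
  rw [← le_sub_iff_add_le']
  refine ciSup_le fun w => ?_
  rw [le_sub_iff_add_le', ← payoff_cons k x v hv w]
  exact le_ciSup (bddAbove_payoff h0 hC (k + 1) x) _

theorem value_zero : value φ h 0 = 0 := by
  ext x
  simp [value, payoff]

/-- Each payoff is the Riemann sum of a polygon belonging to K_ℓ. -/
theorem value_le_of_pairing_le (hℓ : 0 ≤ ℓ) (hφ : Continuous φ) {N : ℕ} (hN : 0 < N) {e : ℝ}
    (he : 0 ≤ e) (hmod : ∀ x y, dist x y ≤ ℓ / N → ‖φ x - φ y‖ ≤ e) {S : ℝ}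
    (hS : ∀ γ : Curve n ℓ, γ.charge.pairing φ ≤ S) (x : Rn n) :
    value φ (ℓ / N) N x ≤ S + ℓ * e := by
  refine ciSup_le fun w => ?_
  obtain ⟨γ, hγ⟩ := Curve.exists_polygon hℓ hN x w.1 w.2
  have h1 := (abs_le.1 (γ.abs_pairing_sub_riemannSum_le hℓ hφ hN he hmod)).1
  have h2 : payoff φ (ℓ / N) N x w =
      ∑ j ∈ Finset.range N, inner ℝ (φ (γ.extend hℓ (j * (ℓ / N))))
      (γ.extend hℓ ((j + 1 : ℕ) * (ℓ / N)) - γ.extend hℓ (j * (ℓ / N))) := by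
    refine Finset.sum_congr rfl fun j hj => ?_
    have hj' := Finset.mem_range.1 hj
    rw [hγ j hj'.le, hγ (j + 1) hj', add_sub_add_left_eq_sub, ← smul_sub,
      Finset.sum_range_succ, add_sub_cancel_left, real_inner_smul_right]
  have h3 := hS γ
  linarith

end value

/-- A divergence-free charge tests against a field no better than its total variation allows
for curves. -/
theorem Charge.mul_pairing_le (hℓ : 0 < ℓ) {μ : Charge n} (hμ : μ.div = 0) {φ : Rn n → Rn n}
    (hφ : Continuous φ) (hs : HasCompactSupport φ) {S : ℝ}
    (hS : ∀ γ : Curve n ℓ, γ.charge.pairing φ ≤ S) :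
    ℓ * μ.pairing φ ≤ (VectorMeasure.variation μ).real univ * S := by
  obtain ⟨C, hC⟩ := hs.exists_bound_of_continuous hφ
  set M := (VectorMeasure.variation μ).real univ
  have hM : 0 ≤ M := measureReal_nonneg
  -- The error collects ℓMe from mollifying the step inequality, ℓ²Me from linearizing, and ℓMe from
  -- the Riemann sums.
  have key : ∀ e : ℝ, 0 < e → ℓ * μ.pairing φ ≤ M * S + ℓ * M * (2 + ℓ) * e := by
    intro e he
    obtain ⟨r, hr, hmodr⟩ := exists_pos_modulus hφ hs he
    let ρ : ContDiffBump (0 : Rn n) := ⟨r / 2, r, by positivity, by linarith⟩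
    have hD := derivMass_nonneg ρ
    -- The kernel is fixed before the time step, so the step can be taken small enough to absorb
    -- `derivMass ρ`.
    set e' := e / (1 + derivMass ρ) with he'
    have he'0 : 0 < e' := by positivity
    have he'1 : e' * (1 + derivMass ρ) = e := by rw [he']; field_simp
    have he'e : e' ≤ e := by nlinarith
    have heD : e' * derivMass ρ ≤ e := by nlinarith
    obtain ⟨δ, hδ, hmod⟩ := exists_pos_modulus hφ hs he'0
    obtain ⟨N, hN, hNδ⟩ := exists_nat_div_le ℓ hδ
    have hN' : (0 : ℝ) < N := by exact_mod_cast hN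
    set h : ℝ := ℓ / N with hh
    have h0 : 0 < h := by positivity
    have hNh : N * h = ℓ := by rw [hh]; field_simp
    have hmodh : ∀ x y, dist x y ≤ h → ‖φ x - φ y‖ ≤ e' := fun x y hxy =>
      hmod x y (hxy.trans hNδ)
    let A : ℕ → ℝ := fun k => ∫ x, mollify ρ (value φ h k) x ∂(VectorMeasure.variation μ)
    have hstep : ∀ k ∈ Finset.range N,
        h * μ.pairing φ - h * (e + ℓ * e) * M ≤ A (k + 1) - A k := by
      intro k hk
      have hk' : (k : ℝ) ≤ N := by exact_mod_cast (Finset.mem_range.1 hk).le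
      have h1 := Charge.mul_pairing_le_of_step ρ hμ hφ hs
        (continuous_value h0.le hφ hs (k + 1)) (hasCompactSupport_value h0.le hs (k + 1))
        (continuous_value h0.le hφ hs k) (hasCompactSupport_value h0.le hs k) h0 hmodr
        (m := ℓ * e') (fun x y hxy => ?_) (fun x w hw => le_value_succ h0.le hC k x w hw)
      · have h2 : h * (e + ℓ * e' * derivMass ρ) * M ≤ h * (e + ℓ * e) * M := by
          rw [mul_assoc ℓ]
          gcongr
        simp only [A]
        linarith
      · refine (abs_value_sub_le h0.le hC hmodh k hxy).trans ?_
        rw [← mul_assoc, ← hNh]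
        gcongr
    -- The increments telescope, starting from `A 0 = 0`.
    have hsum := Finset.sum_le_sum hstep
    rw [Finset.sum_range_sub, Finset.sum_const, Finset.card_range, nsmul_eq_mul] at hsum
    have hA0 : A 0 = 0 := by simp [A, value_zero, mollify_apply]
    have hAN : A N ≤ M * (S + ℓ * e) := by
      have h1 : ∀ x, mollify ρ (value φ h N) x ≤ S + ℓ * e :=
        mollify_le ρ (continuous_value h0.le hφ hs N) fun x =>
          (value_le_of_pairing_le hℓ.le hφ hN he'0.le hmodh hS x).trans (by gcongr)
      have h2 : Integrable (mollify ρ (value φ h N)) (VectorMeasure.variation μ) :=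
        (contDiff_mollify ρ (continuous_value h0.le hφ hs N)).continuous
          |>.integrable_of_hasCompactSupport
            (hasCompactSupport_mollify ρ (hasCompactSupport_value h0.le hs N))
      refine (integral_mono h2 (integrable_const _) h1).trans ?_
      rw [integral_const, smul_eq_mul]
    have h3 : N * (h * μ.pairing φ - h * (e + ℓ * e) * M) =
        ℓ * μ.pairing φ - ℓ * (e + ℓ * e) * M := by
      rw [← hNh]; ring
    rw [h3, hA0] at hsum
    nlinarith
  refine le_of_forall_pos_le_add fun ε hε => ?_
  have h1 := key (ε / (ℓ * M * (2 + ℓ) + 1)) (by positivity)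
  refine h1.trans (add_le_add_right ?_ _)
  rw [mul_div_assoc', div_le_iff₀ (by positivity)]
  nlinarith

/-! ### Representation by a measure on curves -/

/-- The Hahn–Banach theorem for a functional that is dominated through a linear map. -/
theorem exists_linearMap_comp_eq_of_le_sublinear {V E : Type*} [AddCommGroup V] [Module ℝ V]
    [AddCommGroup E] [Module ℝ E] (F : V →ₗ[ℝ] E) (L : V →ₗ[ℝ] ℝ) (p : E → ℝ)
    (hsmul : ∀ c : ℝ, 0 < c → ∀ x, p (c • x) = c * p x)
    (hadd : ∀ x y, p (x + y) ≤ p x + p y) (hL : ∀ v, L v ≤ p (F v)) :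
    ∃ g : E →ₗ[ℝ] ℝ, (∀ v, g (F v) = L v) ∧ ∀ x, g x ≤ p x := by
  obtain ⟨s, hs⟩ := F.rangeRestrict.exists_rightInverse_of_surjective F.range_rangeRestrict
  have hFs : ∀ y : LinearMap.range F, F (s y) = y := fun y =>
    congrArg Subtype.val (LinearMap.congr_fun hs y)
  have hp0 : p 0 = 0 := by
    have := hsmul 2 two_pos 0
    rw [smul_zero] at this
    linarith
  -- Domination at ±v makes `L` factor through the range of `F`.
  have hker : ∀ v, F v = 0 → L v = 0 := by
    intro v hv
    have h1 := hL v
    have h2 := hL (-v)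
    rw [map_neg, map_neg, hv, neg_zero, hp0] at h2
    rw [hv, hp0] at h1
    linarith
  obtain ⟨g, hg1, hg2⟩ := exists_extension_of_le_sublinear ⟨LinearMap.range F, L ∘ₗ s⟩ p hsmul hadd
    fun y => by
      have := hL (s y)
      rwa [hFs y] at this
  refine ⟨g, fun v => ?_, hg2⟩
  have h1 := hg1 ⟨F v, v, rfl⟩
  have h2 : L (s ⟨F v, v, rfl⟩ - v) = 0 := hker _ (by rw [map_sub, hFs, sub_self])
  rw [map_sub, sub_eq_zero] at h2
  exact h1.trans h2

open CompactlySupported in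
/-- A linear functional on `C_c(X, ℝ)` dominated by a multiple of the supremum of the positive part
is represented by a measure of the corresponding mass. -/
theorem exists_measure_of_le_iSup {X : Type*} [TopologicalSpace X] [T2Space X]
    [LocallyCompactSpace X] [SigmaCompactSpace X] [Nonempty X] [MeasurableSpace X] [BorelSpace X]
    {c : ℝ} (hc : 0 ≤ c) (g : C_c(X, ℝ) →ₗ[ℝ] ℝ) (hg : ∀ f, g f ≤ c * ⨆ x, max (f x) 0) :
    ∃ ν : Measure X, ν univ ≤ ENNReal.ofReal c ∧ ∀ f : C_c(X, ℝ), g f = ∫ x, f x ∂ν := by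
  -- For f ≥ 0 the positive part of -f vanishes, so the bound reads g(-f) ≤ 0.
  have hpos : ∀ f : C_c(X, ℝ), 0 ≤ f → 0 ≤ g f := by
    intro f hf
    have h1 := hg (-f)
    have h2 : ∀ x, max ((-f) x) 0 = 0 := fun x =>
      max_eq_right (by simpa using hf x)
    simp only [h2, ciSup_const, mul_zero, map_neg] at h1
    linarith
  let Λ : C_c(X, ℝ) →ₚ[ℝ] ℝ := PositiveLinearMap.mk₀ g hpos
  refine ⟨RealRMK.rieszMeasure Λ, ?_, fun f => (RealRMK.integral_rieszMeasure Λ f).symm⟩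
  -- The mass is bounded on an exhaustion by compact sets: a cutoff with values in [0,1] has g-value
  -- at most c.
  have hmono : Monotone (compactCovering X) := compactCovering_subset X
  rw [← iUnion_compactCovering X, hmono.measure_iUnion]
  refine iSup_le fun k => ?_
  obtain ⟨f, hf1, -, hfs, hf01⟩ := exists_continuous_one_zero_of_isCompact
    (isCompact_compactCovering X k) isClosed_empty (disjoint_empty _)
  refine (RealRMK.rieszMeasure_le_of_eq_one Λ (f := ⟨f, hfs⟩) (fun x => (hf01 x).1)
    (isCompact_compactCovering X k) fun x hx => hf1 hx).trans (ENNReal.ofReal_le_ofReal ?_)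
  refine (hg _).trans (mul_le_of_le_one_right hc (ciSup_le fun x => ?_))
  exact max_le (hf01 x).2 zero_le_one

open CompactlySupported in
/-- The action of curves on a fixed field, as a function of the curve. -/
def pairingMap (hℓ : 0 ≤ ℓ) : C_c(Rn n, Rn n) →ₗ[ℝ] C_c(Curve n ℓ, ℝ) where
  toFun φ := ⟨⟨fun γ => γ.charge.pairing φ,
    Curve.continuous_pairing hℓ φ.continuous φ.hasCompactSupport⟩,
    Curve.hasCompactSupport_pairing φ.continuous φ.hasCompactSupport⟩
  map_add' φ ψ := by
    ext γ
    exact γ.charge.pairing_add (γ.charge.integrable_of_continuous φ.continuous φ.hasCompactSupport)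
      (γ.charge.integrable_of_continuous ψ.continuous ψ.hasCompactSupport)
  map_smul' c φ := by
    ext γ
    exact γ.charge.pairing_smul c φ

open CompactlySupported in
/-- The action of a charge on continuous fields of compact support. -/
def Charge.pairingFunctional (μ : Charge n) : C_c(Rn n, Rn n) →ₗ[ℝ] ℝ where
  toFun φ := μ.pairing φ
  map_add' φ ψ := μ.pairing_add (μ.integrable_of_continuous φ.continuous φ.hasCompactSupport)
      (μ.integrable_of_continuous ψ.continuous ψ.hasCompactSupport)
  map_smul' c φ := μ.pairing_smul c φ

open CompactlySupported in
theorem bddAbove_range_max_zero {X : Type*} [TopologicalSpace X] (f : C_c(X, ℝ)) :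
    BddAbove (range fun x => max (f x) 0) := by
  obtain ⟨C, hC⟩ := f.hasCompactSupport.exists_bound_of_continuous f.continuous
  refine ⟨max C 0, ?_⟩
  rintro _ ⟨x, rfl⟩
  exact max_le_max_right _ ((le_abs_self _).trans (hC x))

open CompactlySupported in
theorem Charge.exists_isDecomposition (hℓ : 0 < ℓ) {μ : Charge n} (hμ : μ.div = 0) :
    ∃ ν : Measure (Curve n ℓ), IsDecomposition μ ν ∧
      ν univ ≤ ENNReal.ofReal ((VectorMeasure.variation μ).real univ / ℓ) := by
  set c := (VectorMeasure.variation μ).real univ / ℓ with hcdef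
  have hc : 0 ≤ c := div_nonneg measureReal_nonneg hℓ.le
  have hsmul : ∀ r : ℝ, 0 < r → ∀ f : C_c(Curve n ℓ, ℝ),
      (c * ⨆ γ, max ((r • f) γ) 0) = r * (c * ⨆ γ, max (f γ) 0) := by
    intro r hr f
    have h1 : ∀ γ, max ((r • f) γ) 0 = r * max (f γ) 0 := fun γ => by
      rw [mul_max_of_nonneg _ _ hr.le, mul_zero]
      rfl
    simp only [h1]
    rw [← Real.mul_iSup_of_nonneg hr.le]
    ring
  have hadd : ∀ f f' : C_c(Curve n ℓ, ℝ), (c * ⨆ γ, max ((f + f') γ) 0) ≤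
      (c * ⨆ γ, max (f γ) 0) + c * ⨆ γ, max (f' γ) 0 := by
    intro f f'
    rw [← mul_add]
    refine mul_le_mul_of_nonneg_left (ciSup_le fun γ => ?_) hc
    have h1 := le_ciSup (bddAbove_range_max_zero f) γ
    have h2 := le_ciSup (bddAbove_range_max_zero f') γ
    refine le_trans (max_le ?_ ?_) (add_le_add h1 h2)
    · exact add_le_add (le_max_left _ _) (le_max_left _ _)
    · exact add_nonneg (le_max_right _ _) (le_max_right _ _)
  have hle : ∀ φ : C_c(Rn n, Rn n),
      μ.pairingFunctional φ ≤ c * ⨆ γ, max (pairingMap hℓ.le φ γ) 0 := by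
    intro φ
    have h1 := Charge.mul_pairing_le hℓ hμ φ.continuous φ.hasCompactSupport
      (S := ⨆ γ, max (pairingMap hℓ.le φ γ) 0) fun γ =>
        (le_max_left _ _).trans (le_ciSup (bddAbove_range_max_zero (pairingMap hℓ.le φ)) γ)
    rw [hcdef, div_mul_eq_mul_div, le_div_iff₀ hℓ, mul_comm]
    exact h1
  obtain ⟨g, hg1, hg2⟩ := exists_linearMap_comp_eq_of_le_sublinear (pairingMap (n := n) hℓ.le)
    μ.pairingFunctional (fun f => c * ⨆ γ, max (f γ) 0) hsmul hadd hle
  obtain ⟨ν, hν1, hν2⟩ := exists_measure_of_le_iSup hc g hg2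
  have : IsFiniteMeasure ν := ⟨hν1.trans_lt ENNReal.ofReal_lt_top⟩
  refine ⟨ν, fun φ hφ hs => ⟨?_, ?_⟩, hν1⟩
  · exact (Curve.continuous_pairing hℓ.le hφ hs).integrable_of_hasCompactSupport
      (Curve.hasCompactSupport_pairing hφ hs)
  · have h1 := hg1 ⟨⟨φ, hφ⟩, hs⟩
    rw [hν2] at h1
    exact h1.symm

/-! ### Consequences of the equality of masses -/

/-- Test with a field bounded by 1 that nearly attains the variation of `μ`. The bound needs no
measurability of `Curve.charge` or its total variation. -/
theorem Charge.variation_univ_le_lintegral_totalVar {μ : Charge n} {ν : Measure (Curve n ℓ)}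
    (h : IsDecomposition μ ν) :
    VectorMeasure.variation μ univ ≤ ∫⁻ γ, γ.charge.totalVar ∂ν := by
  refine le_of_forall_lt fun c hc => ?_
  obtain ⟨φ, hφ, hs, hφ1, hcφ⟩ := μ.exists_pairing_gt hc
  refine (ENNReal.lt_ofReal_iff_toReal_lt hc.ne_top).2 hcφ |>.trans_le ?_
  rw [(h φ hφ hs).2]
  refine (Real.ofReal_le_enorm _).trans ((enorm_integral_le_lintegral_enorm _).trans
    (lintegral_mono fun γ => ?_))
  rw [← ofReal_norm]
  refine (ENNReal.ofReal_le_iff_le_toReal (measure_ne_top _ _)).2 ?_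
  refine (γ.charge.abs_pairing_le φ).trans ?_
  refine (integral_mono (γ.charge.integrable_of_continuous hφ hs).norm (integrable_const 1)
    hφ1).trans ?_
  rw [integral_const, smul_eq_mul, mul_one]
  rfl

theorem measurable_curve_eval :
    Measurable fun p : Curve n ℓ × Icc (0 : ℝ) ℓ => p.1.1 p.2 := by
  refine Continuous.measurable ?_
  exact (continuous_subtype_val.comp continuous_fst).eval continuous_snd

theorem Charge.variation_le_map_eval {μ : Charge n} {ν : Measure (Curve n ℓ)} [IsFiniteMeasure ν]
    (h : IsDecomposition μ ν) :
    VectorMeasure.variation μ ≤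
      (ν.prod (lebesgue ℓ)).map fun p : Curve n ℓ × Icc (0 : ℝ) ℓ => p.1.1 p.2 := by
  refine μ.variation_le_of_pairing_le _ fun φ hφ hs => ?_
  obtain ⟨C, hC⟩ := hs.exists_bound_of_continuous hφ
  have hi : Integrable (fun p : Curve n ℓ × Icc (0 : ℝ) ℓ => ‖φ (p.1.1 p.2)‖)
      (ν.prod (lebesgue ℓ)) := by
    refine Integrable.of_bound
      (hφ.norm.measurable.comp measurable_curve_eval).aestronglyMeasurable C
      (Filter.Eventually.of_forall fun p => ?_)
    simpa using hC _
  rw [integral_map measurable_curve_eval.aemeasurable hφ.norm.aestronglyMeasurable,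
    integral_prod _ hi, (h φ hφ hs).2]
  refine MeasureTheory.norm_integral_le_of_norm_le (f := fun γ : Curve n ℓ => γ.charge.pairing φ)
    hi.integral_prod_left (Filter.Eventually.of_forall fun γ => ?_)
  exact γ.abs_pairing_charge_le hφ hs

/-- Upgrades "at almost every time" to "at every time" for closed conditions on a curve. -/
theorem lebesgue_pos_of_isOpen (hℓ : 0 < ℓ) {U : Set (Icc (0 : ℝ) ℓ)} (hU : IsOpen U)
    (hne : U.Nonempty) : 0 < lebesgue ℓ U := by
  obtain ⟨V, hV, rfl⟩ := isOpen_induced_iff.1 hU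
  obtain ⟨t, ht⟩ := hne
  rw [lebesgue, measurableEmbedding_coe_Icc.comap_apply, Subtype.image_preimage_coe]
  have h1 : (V ∩ Ioo 0 ℓ).Nonempty := by
    refine mem_closure_iff.1 ?_ V hV ht
    rw [closure_Ioo hℓ.ne]
    exact t.2
  refine ((hV.inter isOpen_Ioo).measure_pos volume h1).trans_le (measure_mono ?_)
  exact fun x hx => ⟨Ioo_subset_Icc_self hx.2, hx.1⟩

end Smirnov

end

/-! ### The equality case of the mass estimate -/

open Smirnov in
theorem theorem1 (n : ℕ) (ℓ : ℝ) (hℓ : 0 < ℓ) (μ : Smirnov.Charge n) (hμ : μ.div = 0) :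
    ∃ ν : Measure (Smirnov.Curve n ℓ), IsFiniteMeasure ν ∧
      Smirnov.IsDecomposition μ ν ∧
      Smirnov.VariationDecomposes μ ν ∧
      ∀ᵐ γ ∂ν, (∀ t, γ.1 t ∈ μ.supp) ∧
        γ.charge.totalVar = γ.length ∧ γ.length = ENNReal.ofReal ℓ := by
  obtain ⟨ν, hdec, hν⟩ := Charge.exists_isDecomposition hℓ hμ
  have hfin : IsFiniteMeasure ν := ⟨hν.trans_lt ENNReal.ofReal_lt_top⟩
  have hmass : ENNReal.ofReal ℓ * ν univ ≤ VectorMeasure.variation μ univ := by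
    calc ENNReal.ofReal ℓ * ν univ
        ≤ ENNReal.ofReal ℓ * ENNReal.ofReal ((VectorMeasure.variation μ).real univ / ℓ) := by
          gcongr
      _ = VectorMeasure.variation μ univ := by
          rw [← ENNReal.ofReal_mul hℓ.le, mul_div_cancel₀ _ hℓ.ne', ofReal_measureReal]
  have hle : ∀ γ : Curve n ℓ, γ.charge.totalVar ≤ ENNReal.ofReal ℓ := fun γ =>
    γ.totalVar_charge_le_length.trans γ.length_le
  -- A function below a constant whose integral is no smaller equals it almost everywhere; only the
  -- constant has to be measurable.
  have hae : ∀ᵐ γ : Curve n ℓ ∂ν, γ.charge.totalVar = ENNReal.ofReal ℓ := by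
    refine ae_eq_of_ae_le_of_lintegral_le (Filter.Eventually.of_forall hle) ?_
      aemeasurable_const ?_
    · refine ((lintegral_mono hle).trans_lt ?_).ne
      rw [lintegral_const]
      exact ENNReal.mul_lt_top ENNReal.ofReal_lt_top (measure_lt_top _ _)
    · rw [lintegral_const]
      exact hmass.trans (Charge.variation_univ_le_lintegral_totalVar hdec)
  have heta : VectorMeasure.variation μ =
      (ν.prod (lebesgue ℓ)).map fun p : Curve n ℓ × Icc (0 : ℝ) ℓ => p.1.1 p.2 := by
    refine Measure.eq_of_le_of_measure_univ_eq (Charge.variation_le_map_eval hdec)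
      (le_antisymm (Charge.variation_le_map_eval hdec univ) ?_)
    rw [Measure.map_apply measurable_curve_eval MeasurableSet.univ, preimage_univ,
      ← univ_prod_univ, Measure.prod_prod, lebesgue_univ, mul_comm]
    exact hmass
  have happly : ∀ A, MeasurableSet A → VectorMeasure.variation μ A =
      ∫⁻ γ : Curve n ℓ, lebesgue ℓ (γ.1 ⁻¹' A) ∂ν := by
    intro A hA
    rw [heta, Measure.map_apply measurable_curve_eval hA,
      Measure.prod_apply (measurable_curve_eval hA)]
    rfl
  have hmeas : ∀ A, MeasurableSet A →
      Measurable fun γ : Curve n ℓ => lebesgue ℓ (γ.1 ⁻¹' A) := fun A hA =>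
    measurable_measure_prodMk_left (measurable_curve_eval hA)
  -- Measurability of γ ↦ ‖[γ]‖(A) comes from this: almost everywhere it is the time that γ spends
  -- in A.
  have hvar : ∀ A, MeasurableSet A → ∀ᵐ γ : Curve n ℓ ∂ν,
      lebesgue ℓ (γ.1 ⁻¹' A) = VectorMeasure.variation γ.charge A := by
    intro A hA
    filter_upwards [hae] with γ hγ
    rw [γ.variation_charge_eq_of_totalVar_eq hγ, Measure.map_apply γ.1.continuous.measurable hA]
  have hclosed : IsClosed μ.supp := Measure.isClosed_support
  have hnull : ∀ᵐ γ : Curve n ℓ ∂ν, lebesgue ℓ (γ.1 ⁻¹' μ.suppᶜ) = 0 := by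
    refine (lintegral_eq_zero_iff (hmeas _ hclosed.measurableSet.compl)).1 ?_
    rw [← happly _ hclosed.measurableSet.compl]
    exact Measure.measure_compl_support
  refine ⟨ν, hfin, hdec, fun A hA => ⟨?_, ?_⟩, ?_⟩
  · exact (hmeas A hA).aemeasurable.congr (hvar A hA)
  · rw [happly A hA]
    exact lintegral_congr_ae (hvar A hA)
  · filter_upwards [hae, hnull] with γ hγ hγ0
    have hlen : γ.length = ENNReal.ofReal ℓ :=
      le_antisymm γ.length_le (hγ ▸ γ.totalVar_charge_le_length)
    refine ⟨fun t => ?_, hγ.trans hlen.symm, hlen⟩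
    by_contra ht
    exact (lebesgue_pos_of_isOpen hℓ (hclosed.isOpen_compl.preimage γ.1.continuous)
      ⟨t, ht⟩).ne' hγ0
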